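/- Let $N\ge 1$, $s\in(0,1)$, and let $g:\mathbb{R}^N\setminus\{0\}\to\mathbb{R}$ be a kernel belonging to $L^1_{loc}(\mathbb{R}^N)$ such that (g1) $g\ge 0$ and $g(\lambda x)\le g(x)$ for all $x\in\mathbb{R}^N\setminus\{0\}$ and $\lambda\ge 1$; (g2) $g(-x)=g(x)$ for all $x\in\mathbb{R}^N\setminus\{0\}$; (g4) $g(x)\to 0$ as $|x|\to\infty$. For a Lebesgue measurable set $E\subset\mathbb{R}^N$ with Lebesgue measure $|E|$, put $$\mathcal{E}_{s,g}(E)=\int_E\int_{E^c}\frac{dx\,dy}{|x-y|^{N+s}}+\int_E\int_E g(x-y)\,dx\,dy\in[0,\infty],$$ and for $m>0$ let $$E_{s,g}[m]=\inf\Big\{\mathcal{E}_{s,g}(E)\;:\; E \text{ measurable},\ |E|=m\Big\},\qquad \widetilde E_{s,g}[m]=\inf\Big\{\sum_{k=1}^\infty\mathcal{E}_{s,g}(E^k)\;:\; E^k\text{ measurable for all } k,\ \sum_{k=1}^\infty|E^k|=m\Big\}.$$ Then, for every $m>0$, there exists a generalized minimizer consisting of finitely many sets: there are $M\in\mathbb{N}$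 and measurable sets $E^1,\dots,E^M\subset\mathbb{R}^N$ (with $E^k=\emptyset$ for $k>M$) such that $$\sum_{k=1}^M|E^k|=m,\qquad \sum_{k=1}^M\mathcal{E}_{s,g}(E^k)=\widetilde E_{s,g}[m],$$ and every $E^k$ minimizes $\mathcal{E}_{s,g}$ among all measurable sets of volume $|E^k|$. Moreover $\widetilde E_{s,g}[m]<\infty$ and $E_{s,g}[m]=\widetilde E_{s,g}[m]$. -/

import Mathlib

open MeasureTheory Filter Topology
open scoped ENNReal

noncomputable section

namespace LiquidDrop

/-- The space `ℝ^N` with its Euclidean norm and Lebesgue measure. -/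
abbrev Space (N : ℕ) : Type := EuclideanSpace ℝ (Fin N)

/-- Lebesgue measurability of a subset of `ℝ^N` (measurability with respect to the completion of
the Borel sigma-algebra under Lebesgue measure). -/
def LebesgueMeasurable {N : ℕ} (E : Set (Space N)) : Prop :=
  NullMeasurableSet E volume

/-- The fractional `s`-perimeter `P_s(E) = ∫_E ∫_{E^c} |x - y|^{-(N+s)} dx dy ∈ [0, ∞]`. -/
def fracPerimeter {N : ℕ} (s : ℝ) (E : Set (Space N)) : ℝ≥0∞ :=
  ∫⁻ y in E, ∫⁻ x in Eᶜ, ENNReal.ofReal (1 / ‖x - y‖ ^ ((N : ℝ) + s))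

/-- The generalized Riesz potential `V_g(E) = ∫_E ∫_E g(x - y) dx dy ∈ [0, ∞]` of a non-negative
kernel `g`. The diagonal is a null set in dimension at least one, so the value of `g` at the origin
plays no role. -/
def rieszPotential {N : ℕ} (g : Space N → ℝ) (E : Set (Space N)) : ℝ≥0∞ :=
  ∫⁻ y in E, ∫⁻ x in E, ENNReal.ofReal (g (x - y))

/-- The energy `P_s(E) + V_g(E)`. -/
def energy {N : ℕ} (s : ℝ) (g : Space N → ℝ) (E : Set (Space N)) : ℝ≥0∞ :=
  fracPerimeter s E + rieszPotential g E

/-- The infimum of the energy among the measurable sets of volume `m`. -/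
def minEnergy {N : ℕ} (s : ℝ) (g : Space N → ℝ) (m : ℝ≥0∞) : ℝ≥0∞ :=
  sInf {e | ∃ E : Set (Space N), LebesgueMeasurable E ∧ volume E = m ∧ e = energy s g E}

/-- `E` minimizes the energy among the measurable sets of volume `|E|`. -/
def IsMinimizer {N : ℕ} (s : ℝ) (g : Space N → ℝ) (E : Set (Space N)) : Prop :=
  LebesgueMeasurable E ∧
    ∀ F : Set (Space N), LebesgueMeasurable F → volume F = volume E →
      energy s g E ≤ energy s g F

/-- Countable families of measurable sets with total volume `m`: the competitors of the
generalized problem. -/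
def IsAdmissible {N : ℕ} (m : ℝ≥0∞) (E : ℕ → Set (Space N)) : Prop :=
  (∀ k, LebesgueMeasurable (E k)) ∧ ∑' k, volume (E k) = m

/-- The generalized energy of a countable family: the sum of the energies of its members. -/
def genEnergy {N : ℕ} (s : ℝ) (g : Space N → ℝ) (E : ℕ → Set (Space N)) : ℝ≥0∞ :=
  ∑' k, energy s g (E k)

/-- The infimum of the generalized energy among the countable families of total volume `m`. -/
def genMinEnergy {N : ℕ} (s : ℝ) (g : Space N → ℝ) (m : ℝ≥0∞) : ℝ≥0∞ :=
  sInf {e | ∃ E : ℕ → Set (Space N), IsAdmissible m E ∧ e = genEnergy s g E}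

/-- A generalized minimizer of volume `m`. -/
def IsGenMinimizer {N : ℕ} (s : ℝ) (g : Space N → ℝ) (m : ℝ≥0∞)
    (E : ℕ → Set (Space N)) : Prop :=
  IsAdmissible m E ∧ genEnergy s g E = genMinEnergy s g m

/-- The kernel is non-negative and radially non-increasing away from the origin. -/
def RadiallyNonincreasing {N : ℕ} (g : Space N → ℝ) : Prop :=
  (∀ x : Space N, x ≠ 0 → 0 ≤ g x) ∧
    ∀ x : Space N, x ≠ 0 → ∀ l : ℝ, 1 ≤ l → g (l • x) ≤ g x

/-- The kernel is symmetric with respect to the origin. -/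
def SymmetricKernel {N : ℕ} (g : Space N → ℝ) : Prop :=
  ∀ x : Space N, x ≠ 0 → g (-x) = g x

/-- The kernel vanishes at infinity: `g(x) → 0` as `|x| → ∞`. -/
def VanishesAtInfinity {N : ℕ} (g : Space N → ℝ) : Prop :=
  Tendsto g (Bornology.cobounded (Space N)) (𝓝 0)

end LiquidDrop

end

/-! The difficulty is loss of compactness: a minimizing sequence may break into pieces that drift
apart. Since `g` vanishes at infinity, distant pieces interact less and less, so in the limit their
energies add up, and the generalized problem records exactly this.

The infimum `dropInf` of the energy at fixed volume is replaced by its lower semicontinuous envelope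
`relaxedInf` in the volume. Volumes along a sequence then need only converge, and continuity of
`dropInf` is never required. Three facts carry the proof.

Lossless splitting (`exists_split`): a bound on the perimeter excludes vanishing, so translates of
almost minimizing sets have an a.e. limit `F` of positive volume. The energy separates
asymptotically into that of `F` and that of the remainder (`dropEnergy_add_liminf_diff_le`).

Subadditivity (`dropInf_add_le`): two sets are moved far apart, and a dilation close to the identity
restores the volume lost in their overlap.

No small pieces (`exists_le_of_split`): multiplying the volume by `c ≥ 1` through a dilation
multiplies the energy by at most `c ^ 2`, so dropping a small volume `a` and rescaling the rest
costs `O(a)`. A set of small volume `a` has energy at least `L * a` with `L` as large as desired.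
Lossless pieces therefore have volume bounded below, and repeated splitting stops
(`exists_finite_family`).

The resulting finite family has energy at most `relaxedInf`, which is a lower bound for all
countable families. Subadditivity bounds `dropInf` by the same finite sum, so the three infima
agree. Replacing one member by a competitor of equal volume cannot lower the sum, so each member is
a minimizer. -/

namespace LiquidDrop

/-! ### Pair interactions under translation, reflection and dilation -/

variable {N : ℕ}

/-- The measure on pairs of points with density `k(y - x)` at `(x, y)`. -/
noncomputable def kernelMeasure (k : Space N → ℝ≥0∞) : Measure (Space N × Space N) :=
  ((volume : Measure (Space N)).prod volume).withDensity fun p => k (p.2 - p.1)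

theorem measurable_kernel_sub {k : Space N → ℝ≥0∞} (hk : Measurable k) :
    Measurable fun p : Space N × Space N => k (p.2 - p.1) := by
  fun_prop

theorem kernelMeasure_prod {k : Space N → ℝ≥0∞} (hk : Measurable k) {A B : Set (Space N)}
    (hA : MeasurableSet A) (hB : MeasurableSet B) :
    kernelMeasure k (A ×ˢ B) = ∫⁻ y in A, ∫⁻ x in B, k (x - y) := by
  rw [kernelMeasure, withDensity_apply _ (hA.prod hB), ← Measure.prod_restrict,
    lintegral_prod _ (measurable_kernel_sub hk).aemeasurable]

/-- Slicing the pair interaction by the difference of the two points. -/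
theorem kernelMeasure_prod_eq_lintegral {k : Space N → ℝ≥0∞} (hk : Measurable k)
    {A B : Set (Space N)} (hA : MeasurableSet A) (hB : MeasurableSet B) :
    kernelMeasure k (A ×ˢ B) =
      ∫⁻ z, k z * volume (A ∩ (fun y => y + z) ⁻¹' B) := by
  have h1 : ∀ y, ∫⁻ x in B, k (x - y) = ∫⁻ z, B.indicator 1 (y + z) * k z := by
    intro y
    rw [← lintegral_indicator hB, ← lintegral_add_left_eq_self _ y]
    refine lintegral_congr fun z => ?_
    by_cases h : y + z ∈ B <;> simp [h]
  have hi : ∀ {C : Set (Space N)}, MeasurableSet C →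
      Measurable (C.indicator (1 : Space N → ℝ≥0∞)) := fun hC => measurable_one.indicator hC
  have hiB : Measurable fun p : Space N × Space N => B.indicator (1 : Space N → ℝ≥0∞) (p.1 + p.2) :=
    (hi hB).comp (measurable_fst.add measurable_snd)
  have hm : Measurable fun p : Space N × Space N =>
      A.indicator (1 : Space N → ℝ≥0∞) p.1 * (B.indicator 1 (p.1 + p.2) * k p.2) :=
    ((hi hA).comp measurable_fst).mul (hiB.mul (hk.comp measurable_snd))
  rw [kernelMeasure_prod hk hA hB, ← lintegral_indicator hA]
  have h2 : ∀ y, A.indicator (fun y => ∫⁻ x in B, k (x - y)) y =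
      ∫⁻ z, A.indicator (1 : Space N → ℝ≥0∞) y * (B.indicator 1 (y + z) * k z) := by
    intro y
    by_cases h : y ∈ A
    · simp [h, h1]
    · simp [h]
  simp_rw [h2]
  rw [lintegral_lintegral_swap hm.aemeasurable]
  refine lintegral_congr fun z => ?_
  have hS : MeasurableSet (A ∩ (fun y => y + z) ⁻¹' B) :=
    hA.inter ((measurable_add_const z) hB)
  rw [← lintegral_indicator_one hS, ← lintegral_const_mul _ (hi hS)]
  refine lintegral_congr fun y => ?_
  by_cases h : y ∈ A <;> by_cases h' : y + z ∈ B <;> simp [h, h']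

/-- The translate of `A` by `v`. -/
def translate (v : Space N) (A : Set (Space N)) : Set (Space N) := (fun x => x - v) ⁻¹' A

theorem measurableSet_translate (v : Space N) {A : Set (Space N)} (hA : MeasurableSet A) :
    MeasurableSet (translate v A) :=
  measurable_sub_const v hA

theorem volume_translate (v : Space N) (A : Set (Space N)) :
    volume (translate v A) = volume A := by
  simpa only [translate, sub_eq_add_neg] using measure_preimage_add_right volume (-v) A

theorem translate_compl (v : Space N) (A : Set (Space N)) :
    translate v Aᶜ = (translate v A)ᶜ := rfl

theorem kernelMeasure_translate {k : Space N → ℝ≥0∞} (hk : Measurable k)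
    {A B : Set (Space N)} (hA : MeasurableSet A) (hB : MeasurableSet B) (v : Space N) :
    kernelMeasure k (translate v A ×ˢ translate v B) = kernelMeasure k (A ×ˢ B) := by
  rw [kernelMeasure_prod_eq_lintegral hk (measurableSet_translate v hA)
    (measurableSet_translate v hB), kernelMeasure_prod_eq_lintegral hk hA hB]
  refine lintegral_congr fun z => ?_
  rw [← volume_translate v (A ∩ (fun y => y + z) ⁻¹' B)]
  congr 2
  ext y
  simp [translate, sub_add_eq_add_sub]

/-- Interactions of an even kernel are symmetric. -/
theorem kernelMeasure_prod_comm {k : Space N → ℝ≥0∞} (hk : Measurable k)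
    (hev : ∀ᵐ z, k (-z) = k z) {A B : Set (Space N)}
    (hA : MeasurableSet A) (hB : MeasurableSet B) :
    kernelMeasure k (A ×ˢ B) = kernelMeasure k (B ×ˢ A) := by
  rw [kernelMeasure_prod_eq_lintegral hk hA hB, kernelMeasure_prod_eq_lintegral hk hB hA,
    ← lintegral_neg_eq_self]
  refine lintegral_congr_ae (hev.mono fun z hz => ?_)
  simp only [hz]
  rw [← measure_preimage_add_right volume z (A ∩ (fun y => y + -z) ⁻¹' B)]
  congr 2
  ext y
  simp [and_comm]

/-- The image of `A` under the dilation by `c`. -/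
def dilate (c : ℝ) (A : Set (Space N)) : Set (Space N) := (fun x => c⁻¹ • x) ⁻¹' A

theorem measurableSet_dilate (c : ℝ) {A : Set (Space N)} (hA : MeasurableSet A) :
    MeasurableSet (dilate c A) :=
  measurable_const_smul c⁻¹ hA

theorem dilate_compl (c : ℝ) (A : Set (Space N)) : dilate c Aᶜ = (dilate c A)ᶜ := rfl

theorem volume_dilate {c : ℝ} (hc : 0 < c) (A : Set (Space N)) :
    volume (dilate c A) = ENNReal.ofReal (c ^ N) * volume A := by
  rw [dilate, Measure.addHaar_preimage_smul _ (inv_ne_zero hc.ne')]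
  simp [abs_of_pos (pow_pos hc N)]

theorem lintegral_comp_smul {f : Space N → ℝ≥0∞} (hf : Measurable f) {c : ℝ} (hc : 0 < c) :
    ∫⁻ z, f z = ENNReal.ofReal (c ^ N) * ∫⁻ z, f (c • z) := by
  have h := lintegral_map (μ := (volume : Measure (Space N))) hf (measurable_const_smul c)
  rw [Measure.map_addHaar_smul _ hc.ne', lintegral_smul_measure] at h
  rw [← h, smul_eq_mul, ← mul_assoc, ← ENNReal.ofReal_mul (by positivity)]
  have : 0 < c ^ N := pow_pos hc N
  simp [abs_of_pos this, mul_inv_cancel₀ this.ne']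

theorem measurable_volume_inter_shift {A B : Set (Space N)} (hA : MeasurableSet A)
    (hB : MeasurableSet B) :
    Measurable fun z : Space N => volume (A ∩ (fun y => y + z) ⁻¹' B) := by
  have h : MeasurableSet {p : Space N × Space N | p.2 ∈ A ∧ p.2 + p.1 ∈ B} :=
    (measurable_snd hA).inter ((measurable_snd.add measurable_fst) hB)
  exact measurable_measure_prodMk_left h

/-- Interactions of a radially non-increasing kernel grow at most quadratically in the volume under
dilations. -/
theorem kernelMeasure_dilate_le {k : Space N → ℝ≥0∞} (hk : Measurable k) {c : ℝ} (hc : 1 ≤ c)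
    (hmono : ∀ᵐ z, k (c • z) ≤ k z) {A B : Set (Space N)}
    (hA : MeasurableSet A) (hB : MeasurableSet B) :
    kernelMeasure k (dilate c A ×ˢ dilate c B) ≤
      ENNReal.ofReal (c ^ N) ^ 2 * kernelMeasure k (A ×ˢ B) := by
  have hc0 : 0 < c := by linarith
  -- The substitution `z ↦ c • z` yields one factor `c ^ N`; the volume of the dilated slice yields
  -- the other.
  rw [kernelMeasure_prod_eq_lintegral hk (measurableSet_dilate c hA) (measurableSet_dilate c hB),
    kernelMeasure_prod_eq_lintegral hk hA hB,
    lintegral_comp_smul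
      (f := fun z => k z * volume (dilate c A ∩ (fun y => y + z) ⁻¹' dilate c B))
      (hk.mul (measurable_volume_inter_shift (measurableSet_dilate c hA)
      (measurableSet_dilate c hB))) hc0, sq, mul_assoc]
  refine mul_le_mul_right ?_ _
  rw [← lintegral_const_mul' _ _ ENNReal.ofReal_ne_top]
  refine lintegral_mono_ae (hmono.mono fun z hz => ?_)
  have hset : dilate c A ∩ (fun y => y + c • z) ⁻¹' dilate c B =
      dilate c (A ∩ (fun y => y + z) ⁻¹' B) := by
    ext y
    simp [dilate, smul_smul, inv_mul_cancel₀ hc0.ne']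
  rw [hset, volume_dilate hc0, mul_left_comm]
  gcongr

/-! ### The kernels and the energy -/

/-- The kernel `|z|^{-(N+s)}` of the fractional perimeter. -/
noncomputable def powerKernel (N : ℕ) (s : ℝ) : Space N → ℝ≥0∞ :=
  fun z => ENNReal.ofReal (1 / ‖z‖ ^ ((N : ℝ) + s))

theorem measurable_powerKernel (N : ℕ) (s : ℝ) : Measurable (powerKernel N s) := by
  unfold powerKernel
  fun_prop

theorem powerKernel_neg (s : ℝ) (z : Space N) : powerKernel N s (-z) = powerKernel N s z := by
  simp [powerKernel]

/-- The origin must be excluded: with `1 / 0 = 0` the kernel takes the value `0` there. -/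
theorem le_powerKernel {s : ℝ} (hs : 0 < s) {r : ℝ} {z : Space N} (hz : z ≠ 0) (hzr : ‖z‖ ≤ r) :
    ENNReal.ofReal (1 / r ^ ((N : ℝ) + s)) ≤ powerKernel N s z := by
  have hz' : 0 < ‖z‖ := norm_pos_iff.2 hz
  refine ENNReal.ofReal_le_ofReal (one_div_le_one_div_of_le (Real.rpow_pos_of_pos hz' _) ?_)
  exact Real.rpow_le_rpow hz'.le hzr (by positivity)

theorem powerKernel_smul_le {s : ℝ} (hs : 0 < s) {c : ℝ} (hc : 1 ≤ c) (z : Space N) :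
    powerKernel N s (c • z) ≤ powerKernel N s z := by
  rcases eq_or_ne z 0 with rfl | hz
  · simp
  have hz' : 0 < ‖z‖ := norm_pos_iff.2 hz
  refine ENNReal.ofReal_le_ofReal (one_div_le_one_div_of_le (Real.rpow_pos_of_pos hz' _) ?_)
  refine Real.rpow_le_rpow hz'.le ?_ (by positivity)
  rw [norm_smul, Real.norm_eq_abs, abs_of_nonneg (by linarith)]
  nlinarith

/-- The properties of a repulsive interaction kernel used below, up to null sets. -/
structure IsRieszKernel (G : Space N → ℝ≥0∞) : Prop where
  measurable : Measurable G
  even : ∀ᵐ z, G (-z) = G z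
  smul_le : ∀ c : ℝ, 1 ≤ c → ∀ᵐ z, G (c • z) ≤ G z
  vanishing : ∀ ε : ℝ≥0∞, 0 < ε → ∃ R : ℝ, ∀ᵐ z, R ≤ ‖z‖ → G z ≤ ε
  lintegral_ball_lt_top : ∀ R : ℝ, ∫⁻ z in Metric.ball 0 R, G z < ∞

/-- The fractional perimeter as the measure of `A × Aᶜ`. -/
noncomputable def perimeter (s : ℝ) (A : Set (Space N)) : ℝ≥0∞ :=
  kernelMeasure (powerKernel N s) (A ×ˢ Aᶜ)

/-- The energy for a kernel with values in `[0, ∞]`. -/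
noncomputable def dropEnergy (s : ℝ) (G : Space N → ℝ≥0∞) (A : Set (Space N)) : ℝ≥0∞ :=
  perimeter s A + kernelMeasure G (A ×ˢ A)

theorem perimeter_le_dropEnergy (s : ℝ) (G : Space N → ℝ≥0∞) (A : Set (Space N)) :
    perimeter s A ≤ dropEnergy s G A := le_self_add

theorem dropEnergy_empty (s : ℝ) (G : Space N → ℝ≥0∞) : dropEnergy s G ∅ = 0 := by
  rw [dropEnergy, perimeter, Set.empty_prod, Set.empty_prod, measure_empty, measure_empty, add_zero]

theorem dropEnergy_translate {s : ℝ} {G : Space N → ℝ≥0∞} (hG : Measurable G)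
    {A : Set (Space N)} (hA : MeasurableSet A) (v : Space N) :
    dropEnergy s G (translate v A) = dropEnergy s G A := by
  rw [dropEnergy, dropEnergy, perimeter, perimeter, ← translate_compl,
    kernelMeasure_translate (measurable_powerKernel N s) hA hA.compl,
    kernelMeasure_translate hG hA hA]

theorem dropEnergy_dilate_le {s : ℝ} (hs : 0 < s) {G : Space N → ℝ≥0∞} (hG : IsRieszKernel G)
    {A : Set (Space N)} (hA : MeasurableSet A) {c : ℝ} (hc : 1 ≤ c) :
    dropEnergy s G (dilate c A) ≤ ENNReal.ofReal (c ^ N) ^ 2 * dropEnergy s G A := by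
  rw [dropEnergy, dropEnergy, mul_add, perimeter, perimeter, ← dilate_compl]
  exact add_le_add (kernelMeasure_dilate_le (measurable_powerKernel N s) hc
    (ae_of_all _ fun z => powerKernel_smul_le hs hc z) hA hA.compl)
    (kernelMeasure_dilate_le hG.measurable hc (hG.smul_le c hc) hA hA)

/-! ### Perimeter of small sets and non-vanishing -/

/-- The lower bound for the perimeter density of sets which fill at most half of every ball of
radius `ρ` centred on them. -/
noncomputable def perimeterDensity (N : ℕ) (s ρ : ℝ) : ℝ≥0∞ :=
  volume (Metric.ball (0 : Space N) ρ) / 2 * ENNReal.ofReal (1 / ρ ^ ((N : ℝ) + s))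

/-- Around each point of `A`, at least half of the ball of radius `ρ` lies in `Aᶜ`, and there the
kernel is at least `ρ ^ (-(N + s))`. -/
theorem perimeterDensity_mul_volume_le {s : ℝ} (hs : 0 < s) (ρ : ℝ) {A : Set (Space N)}
    (hA : MeasurableSet A)
    (h : ∀ y ∈ A, volume (A ∩ Metric.ball y ρ) ≤ volume (Metric.ball (0 : Space N) ρ) / 2) :
    perimeterDensity N s ρ * volume A ≤ perimeter s A := by
  rw [perimeter, kernelMeasure_prod (measurable_powerKernel N s) hA hA.compl,
    ← setLIntegral_const]
  refine setLIntegral_mono' hA fun y hy => ?_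
  have hball : volume (Metric.ball y ρ) = volume (Metric.ball (0 : Space N) ρ) :=
    Measure.addHaar_ball_center _ _ _
  have hfin : volume (Metric.ball (0 : Space N) ρ) ≠ ∞ := measure_ball_lt_top.ne
  have hhalf : volume (Metric.ball (0 : Space N) ρ) / 2 ≤ volume (Aᶜ ∩ Metric.ball y ρ) := by
    have h1 : volume (Metric.ball (0 : Space N) ρ) ≤
        volume (A ∩ Metric.ball y ρ) + volume (Aᶜ ∩ Metric.ball y ρ) := by
      rw [← hball]
      refine le_trans (measure_mono ?_) (measure_union_le _ _)
      intro x hx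
      by_cases hxA : x ∈ A
      · exact Or.inl ⟨hxA, hx⟩
      · exact Or.inr ⟨hxA, hx⟩
    have h2 := h1.trans (add_le_add_left (h y hy) _)
    nth_rewrite 1 [← ENNReal.add_halves (volume (Metric.ball (0 : Space N) ρ))] at h2
    exact (ENNReal.add_le_add_iff_left (ENNReal.div_ne_top hfin (by simp))).1 h2
  calc perimeterDensity N s ρ
      ≤ ENNReal.ofReal (1 / ρ ^ ((N : ℝ) + s)) * volume (Aᶜ ∩ Metric.ball y ρ) := by
        rw [perimeterDensity, mul_comm]
        gcongr
    _ = ∫⁻ _ in Aᶜ ∩ Metric.ball y ρ, ENNReal.ofReal (1 / ρ ^ ((N : ℝ) + s)) := by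
        rw [setLIntegral_const]
    _ ≤ ∫⁻ x in Aᶜ ∩ Metric.ball y ρ, powerKernel N s (x - y) := by
        refine setLIntegral_mono' (hA.compl.inter measurableSet_ball) fun x hx => ?_
        refine le_powerKernel hs (sub_ne_zero.2 ?_) ?_
        · rintro rfl
          exact hx.1 hy
        · exact (mem_ball_iff_norm.1 hx.2).le
    _ ≤ ∫⁻ x in Aᶜ, powerKernel N s (x - y) := lintegral_mono_set Set.inter_subset_left

theorem nontrivial_space (hN : 0 < N) : Nontrivial (Space N) :=
  Module.nontrivial_of_finrank_pos (R := ℝ) (by simpa using hN)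

theorem volume_ball_eq (hN : 0 < N) (x : Space N) {r : ℝ} (hr : 0 ≤ r) :
    volume (Metric.ball x r) = ENNReal.ofReal (r ^ N) * volume (Metric.ball (0 : Space N) 1) := by
  have := nontrivial_space hN
  simpa using Measure.addHaar_ball (volume : Measure (Space N)) x hr

/-- The density is half the volume of the unit ball times `ρ ^ (-s)`, which blows up as `ρ → 0`. The
number `T` below is the required value of `ρ ^ (-s)`. -/
theorem exists_le_perimeterDensity (hN : 0 < N) {s : ℝ} (hs : 0 < s) {L : ℝ≥0∞} (hL : L ≠ ∞) :
    ∃ ρ : ℝ, 0 < ρ ∧ L ≤ perimeterDensity N s ρ := by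
  have hω : volume (Metric.ball (0 : Space N) 1) / 2 ≠ 0 := by
    simp [(Metric.measure_ball_pos volume (0 : Space N) one_pos).ne']
  have hω' : volume (Metric.ball (0 : Space N) 1) / 2 ≠ ∞ :=
    ENNReal.div_ne_top measure_ball_lt_top.ne (by simp)
  obtain ⟨T, hT, hLT⟩ : ∃ T : ℝ, 0 < T ∧
      L ≤ volume (Metric.ball (0 : Space N) 1) / 2 * ENNReal.ofReal T := by
    refine ⟨(L / (volume (Metric.ball (0 : Space N) 1) / 2)).toReal + 1, by positivity, ?_⟩
    rw [mul_comm, ← ENNReal.div_le_iff hω hω']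
    refine (ENNReal.ofReal_toReal (ENNReal.div_ne_top hL hω)).symm.le.trans ?_
    exact ENNReal.ofReal_le_ofReal (by linarith)
  refine ⟨T ^ (-s⁻¹), by positivity, hLT.trans (le_of_eq ?_)⟩
  have hρ : 0 < T ^ (-s⁻¹) := by positivity
  rw [perimeterDensity, volume_ball_eq hN 0 hρ.le, mul_div_assoc, mul_comm (ENNReal.ofReal _),
    mul_assoc, ← ENNReal.ofReal_mul (by positivity), Real.rpow_add hρ, Real.rpow_natCast]
  congr 2
  have hp : 0 < (T ^ (-s⁻¹)) ^ N := by positivity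
  have hinv : (T ^ (-s⁻¹)) ^ s = T⁻¹ := by
    rw [← Real.rpow_mul hT.le, neg_mul, inv_mul_cancel₀ hs.ne', Real.rpow_neg_one]
  rw [hinv]
  field_simp

/-- Small sets have large energy density. -/
theorem exists_mul_volume_le_perimeter (hN : 0 < N) {s : ℝ} (hs : 0 < s) {L : ℝ≥0∞}
    (hL : L ≠ ∞) : ∃ δ : ℝ≥0∞, 0 < δ ∧ ∀ A : Set (Space N), MeasurableSet A →
      volume A ≤ δ → L * volume A ≤ perimeter s A := by
  obtain ⟨ρ, hρ, hLρ⟩ := exists_le_perimeterDensity hN hs hL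
  refine ⟨volume (Metric.ball (0 : Space N) ρ) / 2, ?_, fun A hA hAδ => ?_⟩
  · exact ENNReal.div_pos (Metric.measure_ball_pos volume _ hρ).ne' (by simp)
  · refine le_trans (mul_le_mul_left hLρ _) (perimeterDensity_mul_volume_le hs ρ hA fun y _ => ?_)
    exact (measure_mono Set.inter_subset_left).trans hAδ

/-- Sets of bounded perimeter do not vanish. -/
theorem exists_concentration (hN : 0 < N) {s : ℝ} (hs : 0 < s) {v C : ℝ≥0∞}
    (hv : 0 < v) (hv' : v ≠ ∞) (hC : C ≠ ∞) : ∃ ρ : ℝ, 0 < ρ ∧ ∀ A : Set (Space N), MeasurableSet A →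
      v ≤ volume A → perimeter s A ≤ C →
      ∃ y, volume (Metric.ball (0 : Space N) ρ) / 2 < volume (A ∩ Metric.ball y ρ) := by
  -- With density `(C + 1) / v`, a set of volume at least `v` without concentration would have
  -- perimeter at least `C + 1`.
  obtain ⟨ρ, hρ, hLρ⟩ := exists_le_perimeterDensity (N := N) hN hs (L := (C + 1) / v)
    (ENNReal.div_ne_top (by simp [hC]) hv.ne')
  refine ⟨ρ, hρ, fun A hA hvA hPA => ?_⟩
  by_contra! hcon
  have h1 := perimeterDensity_mul_volume_le hs ρ hA fun y _ => hcon y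
  have h2 : C + 1 ≤ C := by
    calc C + 1 = (C + 1) / v * v := (ENNReal.div_mul_cancel hv.ne' hv').symm
      _ ≤ perimeterDensity N s ρ * volume A := by gcongr
      _ ≤ C := h1.trans hPA
  exact (ENNReal.lt_add_right hC one_ne_zero).not_ge h2

/-! ### Balls have finite energy -/

/-- The part of a ball leaving it under a shift by `z` has volume of order `|z|`. -/
theorem volume_ball_inter_shift_compl_le (hN : 0 < N) {R : ℝ} (hR : 0 < R) (z : Space N) :
    volume (Metric.ball (0 : Space N) R ∩ (fun y => y + z) ⁻¹' (Metric.ball 0 R)ᶜ) ≤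
      ENNReal.ofReal (R ^ N * max 1 (N / R) * min 1 ‖z‖) *
        volume (Metric.ball (0 : Space N) 1) := by
  set ω := volume (Metric.ball (0 : Space N) 1)
  have hN' : (1 : ℝ) ≤ N := by exact_mod_cast hN
  have hmax : (1 : ℝ) ≤ max 1 (N / R) := le_max_left _ _
  have htriv : volume (Metric.ball (0 : Space N) R ∩ (fun y => y + z) ⁻¹' (Metric.ball 0 R)ᶜ) ≤
      ENNReal.ofReal (R ^ N) * ω := by
    rw [← volume_ball_eq hN 0 hR.le]
    exact measure_mono Set.inter_subset_left
  have hRN : 0 < R ^ N := by positivity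
  have hlin : N * ‖z‖ / R ≤ max 1 (N / R) * ‖z‖ := by
    rw [mul_div_right_comm]
    gcongr
    exact le_max_right _ _
  rcases le_total 1 ‖z‖ with h1 | h1
  · refine htriv.trans (mul_le_mul_left (ENNReal.ofReal_le_ofReal ?_) _)
    rw [min_eq_left h1, mul_one]
    nlinarith
  rw [min_eq_right h1]
  rcases le_or_gt R ‖z‖ with h2 | h2
  · refine htriv.trans (mul_le_mul_left (ENNReal.ofReal_le_ofReal ?_) _)
    have h3 : 1 ≤ N * ‖z‖ / R := by
      rw [le_div_iff₀ hR]
      nlinarith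
    nlinarith
  have hsub : Metric.ball (0 : Space N) R ∩ (fun y => y + z) ⁻¹' (Metric.ball 0 R)ᶜ ⊆
      Metric.ball 0 R \ Metric.ball 0 (R - ‖z‖) := by
    rintro y ⟨hy1, hy2⟩
    refine ⟨hy1, fun hy3 => hy2 ?_⟩
    simp only [mem_ball_zero_iff] at hy3 ⊢
    linarith [norm_add_le y z]
  refine (measure_mono hsub).trans ?_
  rw [measure_sdiff (Metric.ball_subset_ball (by linarith [norm_nonneg z]))
    measurableSet_ball.nullMeasurableSet measure_ball_lt_top.ne, volume_ball_eq hN 0 hR.le,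
    volume_ball_eq hN 0 (by linarith : 0 ≤ R - ‖z‖), ← ENNReal.sub_mul
      (fun _ _ => measure_ball_lt_top.ne), ← ENNReal.ofReal_sub _ (by
      have : 0 ≤ R - ‖z‖ := by linarith
      positivity)]
  refine mul_le_mul_left (ENNReal.ofReal_le_ofReal ?_) _
  -- Bernoulli's inequality bounds the volume of the shell of thickness `‖z‖`.
  have hb : 1 + (N : ℝ) * (-(‖z‖ / R)) ≤ (1 + -(‖z‖ / R)) ^ N := by
    refine one_add_mul_le_pow ?_ N
    have : ‖z‖ / R < 1 := (div_lt_one hR).2 h2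
    linarith
  have hfac : (R - ‖z‖) ^ N = R ^ N * (1 + -(‖z‖ / R)) ^ N := by
    rw [← mul_pow]
    congr 1
    field_simp
    ring
  rw [hfac, mul_assoc]
  have : R ^ N * (N * ‖z‖ / R) ≤ R ^ N * (max 1 (N / R) * ‖z‖) := by gcongr
  have h4 := mul_le_mul_of_nonneg_left hb hRN.le
  have h5 : (N : ℝ) * ‖z‖ / R = N * (‖z‖ / R) := by ring
  rw [h5] at this
  nlinarith

/-- In polar coordinates the integrand is `r ^ (-s)` near the origin, integrable as `s < 1`, and `r
^ (-1 - s)` at infinity, integrable as `s > 0`. -/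
theorem integrable_min_one_norm_div (hN : 0 < N) {s : ℝ} (hs0 : 0 < s) (hs1 : s < 1) :
    Integrable (fun z : Space N => min 1 ‖z‖ / ‖z‖ ^ ((N : ℝ) + s)) := by
  have := nontrivial_space hN
  rw [integrable_fun_norm_addHaar volume (f := fun r => min 1 r / r ^ ((N : ℝ) + s)),
    finrank_euclideanSpace, Fintype.card_fin, ← Set.Ioo_union_Ici_eq_Ioi one_pos]
  have hpow : ∀ x : ℝ, 0 < x → x ^ (N - 1) = x ^ ((N : ℝ) - 1) := by
    intro x hx
    rw [← Real.rpow_natCast, Nat.cast_sub hN, Nat.cast_one]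
  refine IntegrableOn.union ?_ ?_
  · refine ((intervalIntegral.integrableOn_Ioo_rpow_iff (s := -s) one_pos).2
      (by linarith)).congr_fun ?_ measurableSet_Ioo
    intro x hx
    simp only [smul_eq_mul]
    rw [min_eq_right hx.2.le, hpow x hx.1, div_eq_mul_inv, ← Real.rpow_neg hx.1.le]
    nth_rewrite 3 [← Real.rpow_one x]
    rw [← Real.rpow_add hx.1, ← Real.rpow_add hx.1]
    congr 1
    ring
  · rw [integrableOn_Ici_iff_integrableOn_Ioi]
    refine ((integrableOn_Ioi_rpow_of_lt (a := -1 - s) (by linarith) one_pos)).congr_fun ?_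
      measurableSet_Ioi
    intro x hx
    have hx0 : 0 < x := one_pos.trans hx
    simp only [smul_eq_mul]
    rw [min_eq_left (le_of_lt hx), hpow x hx0, one_div, ← Real.rpow_neg hx0.le,
      ← Real.rpow_add hx0]
    congr 1
    ring

theorem perimeter_ball_lt_top (hN : 0 < N) {s : ℝ} (hs0 : 0 < s) (hs1 : s < 1) {R : ℝ}
    (hR : 0 < R) : perimeter s (Metric.ball (0 : Space N) R) < ∞ := by
  rw [perimeter, kernelMeasure_prod_eq_lintegral (measurable_powerKernel N s) measurableSet_ball
    measurableSet_ball.compl]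
  set ω := volume (Metric.ball (0 : Space N) 1) with hω
  have hint := (integrable_min_one_norm_div hN hs0 hs1).lintegral_lt_top
  calc _ ≤ ∫⁻ z : Space N, (ENNReal.ofReal (R ^ N * max 1 (N / R)) * ω) *
        ENNReal.ofReal (min 1 ‖z‖ / ‖z‖ ^ ((N : ℝ) + s)) := by
        refine lintegral_mono fun z => ?_
        refine (mul_le_mul_right (volume_ball_inter_shift_compl_le hN hR z) _).trans_eq ?_
        rw [powerKernel, ENNReal.ofReal_mul (by positivity), ← hω,
          div_eq_mul_one_div (min 1 ‖z‖), ENNReal.ofReal_mul (p := min 1 ‖z‖) (by positivity)]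
        simp only [mul_assoc, mul_comm, mul_left_comm]
    _ < ∞ := by
        rw [lintegral_const_mul' _ _ (by finiteness)]
        exact ENNReal.mul_lt_top (by finiteness) hint

/-- Differences of points of the ball have norm less than `2 * R`, so only local integrability of
`G` matters. -/
theorem kernelMeasure_ball_lt_top {G : Space N → ℝ≥0∞} (hG : IsRieszKernel G) (R : ℝ) :
    kernelMeasure G (Metric.ball 0 R ×ˢ Metric.ball 0 R) < ∞ := by
  rw [kernelMeasure_prod_eq_lintegral hG.measurable measurableSet_ball measurableSet_ball]
  calc _ ≤ ∫⁻ z, volume (Metric.ball (0 : Space N) R) *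
        (Metric.ball (0 : Space N) (2 * R)).indicator G z := by
        refine lintegral_mono fun z => ?_
        by_cases hz : z ∈ Metric.ball (0 : Space N) (2 * R)
        · rw [Set.indicator_of_mem hz, mul_comm]
          gcongr
          exact Set.inter_subset_left
        · have : Metric.ball (0 : Space N) R ∩ (fun y => y + z) ⁻¹' Metric.ball 0 R = ∅ := by
            ext y
            simp only [Set.mem_inter_iff, mem_ball_zero_iff, Set.mem_preimage,
              Set.mem_empty_iff_false, iff_false, not_and] at hz ⊢
            intro h1 h2
            have := norm_sub_le (y + z) y
            rw [add_sub_cancel_left] at this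
            linarith
          rw [this, measure_empty, mul_zero]
          exact zero_le
    _ < ∞ := by
        rw [lintegral_const_mul' _ _ measure_ball_lt_top.ne, lintegral_indicator measurableSet_ball]
        exact ENNReal.mul_lt_top measure_ball_lt_top (hG.lintegral_ball_lt_top _)

theorem exists_dropEnergy_lt_top (hN : 0 < N) {s : ℝ} (hs0 : 0 < s) (hs1 : s < 1)
    {G : Space N → ℝ≥0∞} (hG : IsRieszKernel G) {t : ℝ≥0∞} (ht : t ≠ ∞) :
    ∃ A : Set (Space N), MeasurableSet A ∧ volume A = t ∧ dropEnergy s G A < ∞ := by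
  rcases eq_or_ne t 0 with rfl | ht0
  · exact ⟨∅, MeasurableSet.empty, by simp, by simp [dropEnergy_empty]⟩
  have hω := (Metric.measure_ball_pos volume (0 : Space N) one_pos).ne'
  have hω' : volume (Metric.ball (0 : Space N) 1) ≠ ∞ := measure_ball_lt_top.ne
  set q := t / volume (Metric.ball (0 : Space N) 1) with hq
  have hq0 : 0 < q.toReal := ENNReal.toReal_pos (ENNReal.div_pos ht0 hω').ne'
    (ENNReal.div_ne_top ht hω)
  have hR : 0 < q.toReal ^ ((N : ℝ)⁻¹) := by positivity
  refine ⟨Metric.ball 0 (q.toReal ^ ((N : ℝ)⁻¹)), measurableSet_ball, ?_,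
    ENNReal.add_lt_top.2 ⟨perimeter_ball_lt_top hN hs0 hs1 hR, kernelMeasure_ball_lt_top hG _⟩⟩
  rw [volume_ball_eq hN 0 hR.le, Real.rpow_inv_natCast_pow hq0.le hN.ne',
    ENNReal.ofReal_toReal (ENNReal.div_ne_top ht hω), ENNReal.div_mul_cancel hω hω']

/-! ### Compactness of sets of bounded perimeter -/

/-- Pairs of points at distance less than `r` which are separated by `A`. -/
def separatedPairs (r : ℝ) (A : Set (Space N)) : Set (Space N × Space N) :=
  {p | ‖p.2 - p.1‖ < r ∧ ¬(p.1 ∈ A ↔ p.2 ∈ A)}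

theorem measurableSet_separatedPairs (r : ℝ) {A : Set (Space N)} (hA : MeasurableSet A) :
    MeasurableSet (separatedPairs r A) := by
  have h1 : MeasurableSet {p : Space N × Space N | ‖p.2 - p.1‖ < r} :=
    measurableSet_lt (by fun_prop) measurable_const
  have h2 : MeasurableSet {p : Space N × Space N | p.1 ∈ A ↔ p.2 ∈ A} :=
    (measurable_fst hA).iff (measurable_snd hA)
  exact h1.inter h2.compl

/-- A nonlocal Poincaré estimate: the kernel is at least `r ^ (-(N + s))` on these pairs, and either
point may be the one in `A`, whence the factor `2`. -/
theorem volume_separatedPairs_le {s : ℝ} (hs : 0 < s) {r : ℝ} (hr : 0 < r) {A : Set (Space N)}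
    (hA : MeasurableSet A) :
    ((volume : Measure (Space N)).prod volume) (separatedPairs r A) ≤
      ENNReal.ofReal (r ^ ((N : ℝ) + s)) * (2 * perimeter s A) := by
  have hpos : 0 < r ^ ((N : ℝ) + s) := by positivity
  have hsub : separatedPairs r A ⊆ A ×ˢ Aᶜ ∪ Aᶜ ×ˢ A := by
    rintro ⟨x, y⟩ ⟨-, h⟩
    by_cases hx : x ∈ A <;> by_cases hy : y ∈ A <;> simp_all
  have h2 : kernelMeasure (powerKernel N s) (separatedPairs r A) ≤ 2 * perimeter s A := by
    refine (measure_mono hsub).trans ((measure_union_le _ _).trans_eq ?_)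
    rw [kernelMeasure_prod_comm (measurable_powerKernel N s)
      (ae_of_all _ fun z => powerKernel_neg s z) hA.compl hA, two_mul, perimeter]
  have h3 : ENNReal.ofReal (1 / r ^ ((N : ℝ) + s)) *
      ((volume : Measure (Space N)).prod volume) (separatedPairs r A) ≤
      kernelMeasure (powerKernel N s) (separatedPairs r A) := by
    rw [kernelMeasure, withDensity_apply _ (measurableSet_separatedPairs r hA),
      ← setLIntegral_const]
    refine setLIntegral_mono' (measurableSet_separatedPairs r hA) fun p hp => ?_
    refine le_powerKernel hs (sub_ne_zero.2 ?_) hp.1.le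
    intro h
    exact hp.2 (by rw [h])
  calc _ = ENNReal.ofReal (r ^ ((N : ℝ) + s)) * (ENNReal.ofReal (1 / r ^ ((N : ℝ) + s)) *
        ((volume : Measure (Space N)).prod volume) (separatedPairs r A)) := by
        rw [← mul_assoc, ← ENNReal.ofReal_mul hpos.le, mul_one_div_cancel hpos.ne']
        simp
    _ ≤ _ := by
        exact mul_le_mul_right (h3.trans h2) _

/-- Points of `Q` outside `A` are separated from `x` by `A`, and points of `Q` in `B` are separated
from `x` by `B`. The rest of `Q` is controlled by the excess of `A` over `B` in volume. -/
theorem volume_le_of_mem_of_notMem {r : ℝ} {A B Q : Set (Space N)} {x : Space N}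
    (hxA : x ∈ A) (hxB : x ∉ B) (hQ : Q ⊆ Metric.ball x r) :
    volume Q ≤ volume (Prod.mk x ⁻¹' separatedPairs r A) +
      volume (Prod.mk x ⁻¹' separatedPairs r B) + (volume (A ∩ Q) - volume (B ∩ Q)) := by
  have h1 : volume (Q \ A) ≤ volume (Prod.mk x ⁻¹' separatedPairs r A) :=
    measure_mono fun y hy => ⟨mem_ball_iff_norm.1 (hQ hy.1), fun h => hy.2 (h.1 hxA)⟩
  have h2 : volume (B ∩ Q) ≤ volume (Prod.mk x ⁻¹' separatedPairs r B) :=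
    measure_mono fun y hy => ⟨mem_ball_iff_norm.1 (hQ hy.2), fun h => hxB (h.2 hy.1)⟩
  calc volume Q ≤ volume (Q \ A) + volume (A ∩ Q) := by
        refine (measure_mono ?_).trans (measure_union_le _ _)
        intro y hy
        by_cases hyA : y ∈ A
        · exact Or.inr ⟨hyA, hy⟩
        · exact Or.inl ⟨hy, hyA⟩
    _ ≤ volume (Q \ A) + (volume (B ∩ Q) + (volume (A ∩ Q) - volume (B ∩ Q))) := by
        gcongr
        exact le_add_tsub
    _ ≤ _ := by
        rw [← add_assoc]
        gcongr

theorem volume_le_of_mem_symmDiff {r : ℝ} {A B Q : Set (Space N)} {x : Space N}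
    (hx : x ∈ symmDiff A B) (hQ : Q ⊆ Metric.ball x r) :
    volume Q ≤ volume (Prod.mk x ⁻¹' separatedPairs r A) +
      volume (Prod.mk x ⁻¹' separatedPairs r B) +
      ((volume (A ∩ Q) - volume (B ∩ Q)) + (volume (B ∩ Q) - volume (A ∩ Q))) := by
  rcases hx with ⟨hA, hB⟩ | ⟨hB, hA⟩
  · refine (volume_le_of_mem_of_notMem hA hB hQ).trans ?_
    gcongr
    exact le_self_add
  · refine (volume_le_of_mem_of_notMem hB hA hQ).trans ?_
    rw [add_comm (volume (Prod.mk x ⁻¹' separatedPairs r B))]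
    gcongr
    exact le_add_self

/-- Sets of bounded perimeter whose volumes in the balls with centres in a dense sequence converge
form a Cauchy sequence locally in volume. -/
theorem tendsto_volume_symmDiff_inter_ball (hN : 0 < N) {s : ℝ} (hs : 0 < s)
    {A : ℕ → Set (Space N)} (hA : ∀ n, MeasurableSet (A n)) {C : ℝ≥0∞} (hC : C ≠ ∞)
    (hP : ∀ n, perimeter s (A n) ≤ C)
    (hlim : ∀ i j : ℕ, ∃ L, Tendsto (fun n => volume (A n ∩
      Metric.ball (TopologicalSpace.denseSeq (Space N) i) (1 / ((j : ℝ) + 1)))) atTop (𝓝 L))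
    (R : ℝ) :
    Tendsto (fun p : ℕ × ℕ => volume (symmDiff (A p.1) (A p.2) ∩ Metric.ball 0 R))
      atTop (𝓝 0) := by
  classical
  set d := TopologicalSpace.denseSeq (Space N) with hd
  set ω := volume (Metric.ball (0 : Space N) 1) with hω
  have hω0 : ω ≠ 0 := (Metric.measure_ball_pos volume (0 : Space N) one_pos).ne'
  rw [ENNReal.tendsto_nhds_zero]
  intro ε hε
  -- Choice of the scale `δ`: the oscillation at scale `2 * δ` is of order `C * δ ^ (N + s)`,
  -- smaller by a factor of order `δ ^ s` than the volume of a ball of radius `δ` times `C`.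
  obtain ⟨j, hj⟩ : ∃ j : ℕ, ENNReal.ofReal (2 ^ ((N : ℝ) + s) * (1 / ((j : ℝ) + 1)) ^ s) *
      (4 * C) ≤ ω * (ε / 2) := by
    have h1 : Tendsto (fun j : ℕ => ENNReal.ofReal (2 ^ ((N : ℝ) + s) *
        (1 / ((j : ℝ) + 1)) ^ s) * (4 * C)) atTop (𝓝 (ENNReal.ofReal 0 * (4 * C))) := by
      refine ENNReal.Tendsto.mul_const (ENNReal.tendsto_ofReal ?_)
        (Or.inr (ENNReal.mul_ne_top (by simp) hC))
      have h2 := (tendsto_one_div_add_atTop_nhds_zero_nat (𝕜 := ℝ)).rpow_const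
        (p := s) (Or.inr hs.le)
      rw [Real.zero_rpow hs.ne'] at h2
      simpa using h2.const_mul (2 ^ ((N : ℝ) + s))
    rw [ENNReal.ofReal_zero, zero_mul] at h1
    exact ((ENNReal.tendsto_nhds_zero.1 h1) _ (by
      have : 0 < ε / 2 := ENNReal.half_pos hε.ne'
      exact ENNReal.mul_pos hω0 this.ne')).exists
  set δ : ℝ := 1 / ((j : ℝ) + 1) with hδ
  have hδ0 : 0 < δ := by positivity
  have hex : ∀ x : Space N, ∃ i, x ∈ Metric.ball (d i) δ := fun x => by
    obtain ⟨i, hi⟩ := (TopologicalSpace.denseRange_denseSeq (Space N)).exists_dist_lt x hδ0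
    exact ⟨i, hi⟩
  -- The least index gives a measurable choice of a ball of the countable family containing `x`.
  set k : Space N → ℕ := fun x => Nat.find (hex x) with hk
  have hkm : Measurable k := measurable_find hex fun i => measurableSet_ball
  have hkx : ∀ x, x ∈ Metric.ball (d (k x)) δ := fun x => Nat.find_spec (hex x)
  set q : ℝ≥0∞ := ENNReal.ofReal (δ ^ N) * ω with hq
  have hq0 : q ≠ 0 := mul_ne_zero (by simp; positivity) hω0
  have hqtop : q ≠ ∞ := ENNReal.mul_ne_top (by simp) measure_ball_lt_top.ne
  have hvol : ∀ i, volume (Metric.ball (d i) δ) = q := fun i => volume_ball_eq hN _ hδ0.le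
  set a : ℕ → ℕ → ℝ≥0∞ := fun n i => volume (A n ∩ Metric.ball (d i) δ) with ha
  have haq : ∀ n i, a n i ≤ q := fun n i =>
    (measure_mono Set.inter_subset_right).trans_eq (hvol i)
  -- Subtraction is truncated, so the two summands together form the absolute difference of the
  -- volumes.
  set D : ℕ × ℕ → ℕ → ℝ≥0∞ := fun p i => (a p.1 i - a p.2 i) + (a p.2 i - a p.1 i) with hD
  have hDlim : ∀ i, Tendsto (fun p => D p i) atTop (𝓝 0) := by
    intro i
    obtain ⟨L, hL⟩ := hlim i j
    have hLtop : L ≠ ∞ := ne_top_of_le_ne_top hqtop (le_of_tendsto' hL fun n => haq n i)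
    rw [← prod_atTop_atTop_eq]
    have h1 : Tendsto (fun p : ℕ × ℕ => a p.1 i) (atTop ×ˢ atTop) (𝓝 L) := hL.comp tendsto_fst
    have h2 : Tendsto (fun p : ℕ × ℕ => a p.2 i) (atTop ×ˢ atTop) (𝓝 L) := hL.comp tendsto_snd
    simpa using (ENNReal.Tendsto.sub h1 h2 (Or.inl hLtop)).add
      (ENNReal.Tendsto.sub h2 h1 (Or.inl hLtop))
  have hI : Tendsto (fun p => ∫⁻ x in Metric.ball (0 : Space N) R, D p (k x)) atTop (𝓝 0) := by
    have := tendsto_lintegral_filter_of_dominated_convergence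
      (μ := volume.restrict (Metric.ball (0 : Space N) R)) (l := (atTop : Filter (ℕ × ℕ)))
      (F := fun p x => D p (k x)) (f := fun _ => 0) (fun _ => q + q)
      (Eventually.of_forall fun p => (measurable_from_top (f := D p)).comp hkm)
      (Eventually.of_forall fun p => ae_of_all _ fun x =>
        add_le_add (tsub_le_self.trans (haq _ _)) (tsub_le_self.trans (haq _ _)))
      (by
        rw [setLIntegral_const]
        exact ENNReal.mul_ne_top (by simp [hqtop]) measure_ball_lt_top.ne)
      (ae_of_all _ fun x => hDlim (k x))
    simpa using this
  have hq2 : 0 < q * (ε / 2) := ENNReal.mul_pos hq0 (ENNReal.half_pos hε.ne').ne'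
  filter_upwards [ENNReal.tendsto_nhds_zero.1 hI _ hq2] with p hp
  have hosc : ∀ n, ∫⁻ x, volume (Prod.mk x ⁻¹' separatedPairs (2 * δ) (A n)) ≤
      ENNReal.ofReal ((2 * δ) ^ ((N : ℝ) + s)) * (2 * C) := by
    intro n
    rw [← Measure.prod_apply (measurableSet_separatedPairs _ (hA n))]
    refine (volume_separatedPairs_le hs (by positivity) (hA n)).trans ?_
    gcongr
    exact hP n
  have hoscm : ∀ n, Measurable fun x => volume (Prod.mk x ⁻¹' separatedPairs (2 * δ) (A n)) :=
    fun n => measurable_measure_prodMk_left (measurableSet_separatedPairs _ (hA n))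
  have hSm : MeasurableSet (symmDiff (A p.1) (A p.2)) := (hA p.1).symmDiff (hA p.2)
  have hmain : q * volume (symmDiff (A p.1) (A p.2) ∩ Metric.ball 0 R) ≤ q * ε := by
    calc q * volume (symmDiff (A p.1) (A p.2) ∩ Metric.ball 0 R)
        = ∫⁻ _ in symmDiff (A p.1) (A p.2) ∩ Metric.ball 0 R, q := by rw [setLIntegral_const]
      _ ≤ ∫⁻ x in symmDiff (A p.1) (A p.2) ∩ Metric.ball 0 R,
          (volume (Prod.mk x ⁻¹' separatedPairs (2 * δ) (A p.1)) +
          volume (Prod.mk x ⁻¹' separatedPairs (2 * δ) (A p.2)) + D p (k x)) := by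
          refine setLIntegral_mono' (hSm.inter measurableSet_ball) fun x hx => ?_
          rw [← hvol (k x)]
          refine volume_le_of_mem_symmDiff hx.1 ?_
          refine Metric.ball_subset_ball' ?_
          have := Metric.mem_ball'.1 (hkx x)
          linarith
      _ ≤ ∫⁻ x in Metric.ball 0 R,
          (volume (Prod.mk x ⁻¹' separatedPairs (2 * δ) (A p.1)) +
          volume (Prod.mk x ⁻¹' separatedPairs (2 * δ) (A p.2)) + D p (k x)) :=
          lintegral_mono_set Set.inter_subset_right
      _ ≤ ENNReal.ofReal ((2 * δ) ^ ((N : ℝ) + s)) * (2 * C) +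
          ENNReal.ofReal ((2 * δ) ^ ((N : ℝ) + s)) * (2 * C) + q * (ε / 2) := by
          have hm2 : Measurable fun x =>
              volume (Prod.mk x ⁻¹' separatedPairs (2 * δ) (A p.1)) +
              volume (Prod.mk x ⁻¹' separatedPairs (2 * δ) (A p.2)) := (hoscm _).add (hoscm _)
          rw [lintegral_add_left hm2, lintegral_add_left (hoscm _)]
          exact add_le_add (add_le_add ((setLIntegral_le_lintegral _ _).trans (hosc _))
            ((setLIntegral_le_lintegral _ _).trans (hosc _))) hp
      _ = ENNReal.ofReal (δ ^ N) * (ENNReal.ofReal (2 ^ ((N : ℝ) + s) * δ ^ s) * (4 * C)) +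
          q * (ε / 2) := by
          have : ((2 * δ) ^ ((N : ℝ) + s)) = δ ^ N * (2 ^ ((N : ℝ) + s) * δ ^ s) := by
            rw [Real.mul_rpow two_pos.le hδ0.le, Real.rpow_add hδ0, Real.rpow_natCast]
            ring
          rw [this, ENNReal.ofReal_mul (by positivity)]
          ring
      _ ≤ q * (ε / 2) + q * (ε / 2) := by
          refine add_le_add_left ?_ _
          rw [hq, mul_assoc]
          exact mul_le_mul_right hj _
      _ = q * ε := by rw [← mul_add, ENNReal.add_halves]
  exact (ENNReal.mul_le_mul_iff_right hq0 hqtop).1 hmain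

/-- Compactness: sets of bounded fractional perimeter have a subsequence which converges pointwise
almost everywhere. -/
theorem exists_subseq_ae_eventually_mem_iff (hN : 0 < N) {s : ℝ} (hs : 0 < s)
    {A : ℕ → Set (Space N)} (hA : ∀ n, MeasurableSet (A n)) {C : ℝ≥0∞} (hC : C ≠ ∞)
    (hP : ∀ n, perimeter s (A n) ≤ C) :
    ∃ φ : ℕ → ℕ, StrictMono φ ∧ ∃ F : Set (Space N), MeasurableSet F ∧
      ∀ᵐ x, ∀ᶠ n in atTop, (x ∈ A (φ n) ↔ x ∈ F) := by
  set d := TopologicalSpace.denseSeq (Space N) with hd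
  -- Compactness of a countable power of `[0, ∞]` replaces a diagonal argument.
  obtain ⟨L, φ, hφ, hL⟩ := CompactSpace.tendsto_subseq (X := ℕ × ℕ → ℝ≥0∞)
    fun n i => volume (A n ∩ Metric.ball (d i.1) (1 / ((i.2 : ℝ) + 1)))
  rw [tendsto_pi_nhds] at hL
  have hcauchy := tendsto_volume_symmDiff_inter_ball hN hs (A := fun n => A (φ n))
    (fun n => hA _) hC (fun n => hP _) (fun i j => ⟨L (i, j), hL (i, j)⟩)
  -- A further subsequence has consecutive differences of volume at most `2 ^ (-k)` in the ball of
  -- radius `k`. By Borel–Cantelli, membership of almost every point is eventually constant.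
  have hev : ∀ k : ℕ, ∃ M, ∀ n ≥ M, ∀ m ≥ n,
      volume (symmDiff (A (φ n)) (A (φ m)) ∩ Metric.ball 0 k) ≤ (2⁻¹ : ℝ≥0∞) ^ k := by
    intro k
    have h1 := ENNReal.tendsto_nhds_zero.1 (hcauchy k) ((2⁻¹ : ℝ≥0∞) ^ k)
      (ENNReal.pow_pos (by simp) k)
    obtain ⟨⟨M₁, M₂⟩, hM⟩ := eventually_atTop.1 h1
    refine ⟨max M₁ M₂, fun n hn m hm => hM (n, m) ⟨?_, ?_⟩⟩
    · exact (le_max_left _ _).trans hn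
    · exact (le_max_right _ _).trans (hn.trans hm)
  obtain ⟨ψ, hψ, hψ'⟩ := extraction_forall_of_eventually' hev
  refine ⟨φ ∘ ψ, hφ.comp hψ, {x | ∀ᶠ n in atTop, x ∈ A (φ (ψ n))}, ?_, ?_⟩
  · simp only [eventually_atTop, Set.ofPred_exists, Set.ofPred_forall]
    exact MeasurableSet.iUnion fun n => MeasurableSet.iInter fun m =>
      MeasurableSet.iInter fun _ => hA _
  have hsum : ∑' k, volume (symmDiff (A (φ (ψ k))) (A (φ (ψ (k + 1)))) ∩
      Metric.ball (0 : Space N) k) ≠ ∞ := by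
    refine ne_top_of_le_ne_top ?_ (ENNReal.tsum_le_tsum fun k =>
      hψ' k (ψ (k + 1)) (hψ.monotone k.le_succ))
    rw [ENNReal.tsum_geometric]
    simp
  filter_upwards [ae_eventually_notMem hsum] with x hx
  obtain ⟨K, hK⟩ := exists_nat_gt ‖x‖
  obtain ⟨n₀, hn₀⟩ := eventually_atTop.1 hx
  have hstep : ∀ n ≥ max n₀ K, (x ∈ A (φ (ψ (n + 1))) ↔ x ∈ A (φ (ψ n))) := by
    intro n hn
    have h1 := hn₀ n ((le_max_left _ _).trans hn)
    have h2 : x ∈ Metric.ball (0 : Space N) n := by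
      rw [mem_ball_zero_iff]
      exact hK.trans_le (by exact_mod_cast (le_max_right _ _).trans hn)
    have h3 : x ∉ symmDiff (A (φ (ψ n))) (A (φ (ψ (n + 1)))) := fun h => h1 ⟨h, h2⟩
    rw [Set.mem_symmDiff] at h3
    tauto
  have hconst : ∀ n ≥ max n₀ K, (x ∈ A (φ (ψ n)) ↔ x ∈ A (φ (ψ (max n₀ K)))) := by
    intro n hn
    induction n, hn using Nat.le_induction with
    | base => rfl
    | succ n hn ih => exact (hstep n hn).trans ih
  refine eventually_atTop.2 ⟨max n₀ K, fun n hn => (hconst n hn).trans ⟨fun h => ?_, fun h => ?_⟩⟩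
  · exact eventually_atTop.2 ⟨max n₀ K, fun m hm => (hconst m hm).2 h⟩
  · obtain ⟨m, hm⟩ := ((h : ∀ᶠ n in atTop, x ∈ A (φ (ψ n))).and
      (eventually_ge_atTop (max n₀ K))).exists
    exact (hconst m hm.2).1 hm.1

/-! ### Semicontinuity and asymptotic splitting of the energy -/

theorem tendsto_indicator_of_eventually_mem_iff {α : Type*} {S : ℕ → Set α} {T : Set α} {p : α}
    (h : ∀ᶠ n in atTop, (p ∈ S n ↔ p ∈ T)) :
    Tendsto (fun n => (S n).indicator (1 : α → ℝ≥0∞) p) atTop (𝓝 (T.indicator 1 p)) := by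
  refine tendsto_const_nhds.congr' (h.mono fun n hn => ?_)
  by_cases hp : p ∈ T
  · simp [hp, hn.2 hp]
  · simp [hp, mt hn.1 hp]

/-- Fatou's lemma for indicators. -/
theorem measure_le_liminf_of_ae_eventually {α : Type*} [MeasurableSpace α] {ν : Measure α}
    {S : ℕ → Set α} {T : Set α} (hS : ∀ n, MeasurableSet (S n)) (hT : MeasurableSet T)
    (h : ∀ᵐ p ∂ν, ∀ᶠ n in atTop, (p ∈ S n ↔ p ∈ T)) :
    ν T ≤ liminf (fun n => ν (S n)) atTop := by
  calc ν T = ∫⁻ p, T.indicator 1 p ∂ν := (lintegral_indicator_one hT).symm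
    _ = ∫⁻ p, liminf (fun n => (S n).indicator (1 : α → ℝ≥0∞) p) atTop ∂ν :=
        lintegral_congr_ae (h.mono fun p hp =>
          (tendsto_indicator_of_eventually_mem_iff hp).liminf_eq.symm)
    _ ≤ liminf (fun n => ∫⁻ p, (S n).indicator 1 p ∂ν) atTop :=
        lintegral_liminf_le fun n => measurable_one.indicator (hS n)
    _ = liminf (fun n => ν (S n)) atTop := by simp only [lintegral_indicator_one (hS _)]

theorem tendsto_measure_of_ae_eventually {α : Type*} [MeasurableSpace α] {ν : Measure α}
    {S : ℕ → Set α} {T B : Set α} (hS : ∀ n, MeasurableSet (S n)) (hT : MeasurableSet T)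
    (hB : MeasurableSet B) (hB' : ν B ≠ ∞) (hSB : ∀ n, S n ⊆ B)
    (h : ∀ᵐ p ∂ν, ∀ᶠ n in atTop, (p ∈ S n ↔ p ∈ T)) :
    Tendsto (fun n => ν (S n)) atTop (𝓝 (ν T)) :=
  tendsto_measure_of_ae_tendsto_indicator atTop hT hS hB hB' (Eventually.of_forall hSB) h

theorem kernelMeasure_absolutelyContinuous (k : Space N → ℝ≥0∞) :
    kernelMeasure k ≪ (volume : Measure (Space N)).prod volume :=
  withDensity_absolutelyContinuous _ _

theorem ae_kernelMeasure_of_ae (k : Space N → ℝ≥0∞) {P : Space N → Prop} (h : ∀ᵐ x, P x) :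
    ∀ᵐ p ∂kernelMeasure k, P p.1 ∧ P p.2 := by
  refine (kernelMeasure_absolutelyContinuous k).ae_le ?_
  exact (Measure.quasiMeasurePreserving_fst.ae h).and (Measure.quasiMeasurePreserving_snd.ae h)

theorem liminf_add_liminf_le {ι : Type*} {f : Filter ι} (u v : ι → ℝ≥0∞) :
    liminf u f + liminf v f ≤ liminf (fun n => u n + v n) f := by
  rw [liminf_eq_iSup_iInf (u := u), liminf_eq_iSup_iInf (u := v)]
  refine ENNReal.biSup_add_biSup_le' ⟨_, univ_mem⟩ ⟨_, univ_mem⟩ fun S hS T hT => ?_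
  refine le_liminf_of_le (by isBoundedDefault) ?_
  filter_upwards [hS, hT] with n hn hn'
  exact add_le_add (iInf₂_le n hn) (iInf₂_le n hn')

section Convergence

variable {A : ℕ → Set (Space N)} {F : Set (Space N)}

theorem perimeter_le_liminf (s : ℝ) (hA : ∀ n, MeasurableSet (A n)) (hF : MeasurableSet F)
    (h : ∀ᵐ x, ∀ᶠ n in atTop, (x ∈ A n ↔ x ∈ F)) :
    perimeter s F ≤ liminf (fun n => perimeter s (A n)) atTop := by
  refine measure_le_liminf_of_ae_eventually (fun n => (hA n).prod (hA n).compl)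
    (hF.prod hF.compl) ?_
  filter_upwards [ae_kernelMeasure_of_ae _ h] with p hp
  filter_upwards [hp.1, hp.2] with n h1 h2
  simp [h1, h2]

/-- Intersecting with `F` leaves the pairs in `A n \ F` unused, so that their interaction can be
added separately. -/
theorem kernelMeasure_inter_le_liminf (G : Space N → ℝ≥0∞) (hA : ∀ n, MeasurableSet (A n))
    (hF : MeasurableSet F) (h : ∀ᵐ x, ∀ᶠ n in atTop, (x ∈ A n ↔ x ∈ F)) :
    kernelMeasure G (F ×ˢ F) ≤
      liminf (fun n => kernelMeasure G ((A n ∩ F) ×ˢ (A n ∩ F))) atTop := by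
  refine measure_le_liminf_of_ae_eventually
    (fun n => ((hA n).inter hF).prod ((hA n).inter hF)) (hF.prod hF) ?_
  filter_upwards [ae_kernelMeasure_of_ae _ h] with p hp
  filter_upwards [hp.1, hp.2] with n h1 h2
  simp [h1, h2]

theorem kernelMeasure_inter_add_diff_le (G : Space N → ℝ≥0∞) {B : Set (Space N)}
    (hB : MeasurableSet B) (hF : MeasurableSet F) :
    kernelMeasure G ((B ∩ F) ×ˢ (B ∩ F)) + kernelMeasure G ((B \ F) ×ˢ (B \ F)) ≤
      kernelMeasure G (B ×ˢ B) := by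
  rw [← measure_union ?_ ((hB.diff hF).prod (hB.diff hF))]
  · refine measure_mono ?_
    rintro ⟨x, y⟩ (⟨hx, hy⟩ | ⟨hx, hy⟩)
    · exact ⟨hx.1, hy.1⟩
    · exact ⟨hx.1, hy.1⟩
  · rw [Set.disjoint_left]
    rintro ⟨x, y⟩ h1 h2
    exact h2.1.2 h1.1.2

/-- Pairs separated by `F` on which `B` and `F` do not agree. -/
def defectPairs (F B : Set (Space N)) : Set (Space N × Space N) :=
  {p | ¬(p.1 ∈ F ↔ p.2 ∈ F) ∧ ¬((p.1 ∈ B ↔ p.1 ∈ F) ∧ (p.2 ∈ B ↔ p.2 ∈ F))}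

theorem measurableSet_defectPairs {B : Set (Space N)} (hF : MeasurableSet F)
    (hB : MeasurableSet B) : MeasurableSet (defectPairs F B) :=
  MeasurableSet.inter ((measurable_fst hF).iff (measurable_snd hF)).compl
    (((measurable_fst hB).iff (measurable_fst hF)).inter
      ((measurable_snd hB).iff (measurable_snd hF))).compl

/-- The perimeter is additive under removal of `F`, up to the defect. -/
theorem perimeter_add_perimeter_diff_le (s : ℝ) {B : Set (Space N)} (hF : MeasurableSet F) :
    perimeter s F + perimeter s (B \ F) ≤
      perimeter s B + 2 * kernelMeasure (powerKernel N s) (defectPairs F B) := by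
  set ν := kernelMeasure (powerKernel N s)
  -- Off the defect, a pair in `F ×ˢ Fᶜ` lies in `B ×ˢ Bᶜ`, while a pair counted by the perimeter of
  -- `B \ F` lies in `B ×ˢ Bᶜ` but not in `F ×ˢ Fᶜ`. The two contributions are thus disjoint.
  have h1 : perimeter s F ≤ ν (B ×ˢ Bᶜ ∩ F ×ˢ Fᶜ) + ν (defectPairs F B) := by
    refine (measure_mono ?_).trans (measure_union_le _ _)
    rintro ⟨x, y⟩ ⟨hx, hy⟩
    simp only [Set.mem_compl_iff, defectPairs, Set.mem_union, Set.mem_inter_iff, Set.mem_prod,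
      Set.mem_ofPred_eq] at *
    tauto
  have h2 : perimeter s (B \ F) ≤ ν (B ×ˢ Bᶜ \ F ×ˢ Fᶜ) + ν (defectPairs F B) := by
    refine (measure_mono ?_).trans (measure_union_le _ _)
    rintro ⟨x, y⟩ ⟨hx, hy⟩
    simp only [Set.mem_compl_iff, defectPairs, Set.mem_union, Set.mem_sdiff, Set.mem_prod,
      Set.mem_ofPred_eq] at *
    tauto
  calc _ ≤ (ν (B ×ˢ Bᶜ ∩ F ×ˢ Fᶜ) + ν (defectPairs F B)) +
        (ν (B ×ˢ Bᶜ \ F ×ˢ Fᶜ) + ν (defectPairs F B)) := add_le_add h1 h2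
    _ = _ := by
        rw [perimeter, ← measure_inter_add_sdiff (B ×ˢ Bᶜ) (hF.prod hF.compl)]
        ring

/-- Dominated convergence: all defects lie among the pairs separated by `F`, a set of finite kernel
measure because `F` has finite perimeter, and almost every pair eventually leaves them. -/
theorem tendsto_kernelMeasure_defectPairs (s : ℝ) (hA : ∀ n, MeasurableSet (A n))
    (hF : MeasurableSet F) (hPF : perimeter s F ≠ ∞)
    (h : ∀ᵐ x, ∀ᶠ n in atTop, (x ∈ A n ↔ x ∈ F)) :
    Tendsto (fun n => kernelMeasure (powerKernel N s) (defectPairs F (A n))) atTop (𝓝 0) := by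
  set ν := kernelMeasure (powerKernel N s)
  rw [← measure_empty (μ := ν)]
  refine tendsto_measure_of_ae_eventually (B := F ×ˢ Fᶜ ∪ Fᶜ ×ˢ F)
    (fun n => measurableSet_defectPairs hF (hA n)) MeasurableSet.empty
    ((hF.prod hF.compl).union (hF.compl.prod hF)) ?_ ?_ ?_
  · refine ne_top_of_le_ne_top (ENNReal.add_ne_top.2 ⟨hPF, ?_⟩) (measure_union_le _ _)
    rw [← kernelMeasure_prod_comm (measurable_powerKernel N s)
      (ae_of_all _ fun z => powerKernel_neg s z) hF hF.compl]
    exact hPF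
  · rintro n ⟨x, y⟩ ⟨h1, -⟩
    simp only [Set.mem_union, Set.mem_prod, Set.mem_compl_iff]
    simp only at h1
    tauto
  · filter_upwards [ae_kernelMeasure_of_ae _ h] with p hp
    filter_upwards [hp.1, hp.2] with n h1 h2
    simp only [Set.mem_empty_iff_false, iff_false]
    exact fun h3 => h3.2 ⟨h1, h2⟩

/-- Splitting of the energy along a sequence converging to `F` pointwise almost everywhere. -/
theorem dropEnergy_add_liminf_diff_le (s : ℝ) (G : Space N → ℝ≥0∞)
    (hA : ∀ n, MeasurableSet (A n)) (hF : MeasurableSet F) (hPF : perimeter s F ≠ ∞)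
    (h : ∀ᵐ x, ∀ᶠ n in atTop, (x ∈ A n ↔ x ∈ F)) :
    dropEnergy s G F + liminf (fun n => dropEnergy s G (A n \ F)) atTop ≤
      liminf (fun n => dropEnergy s G (A n)) atTop := by
  have hW := ENNReal.Tendsto.const_mul (a := 2)
    (tendsto_kernelMeasure_defectPairs s hA hF hPF h) (Or.inr (by simp))
  rw [mul_zero] at hW
  rw [← ENNReal.liminf_add_of_right_tendsto_zero hW (fun n => dropEnergy s G (A n)), dropEnergy,
    add_assoc]
  calc _ ≤ perimeter s F + (liminf (fun n => kernelMeasure G ((A n ∩ F) ×ˢ (A n ∩ F))) atTop +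
        liminf (fun n => dropEnergy s G (A n \ F)) atTop) := by
        gcongr
        exact kernelMeasure_inter_le_liminf G hA hF h
    _ ≤ perimeter s F + liminf (fun n => kernelMeasure G ((A n ∩ F) ×ˢ (A n ∩ F)) +
          dropEnergy s G (A n \ F)) atTop := by
        gcongr
        exact liminf_add_liminf_le _ _
    _ = liminf (fun n => perimeter s F + (kernelMeasure G ((A n ∩ F) ×ˢ (A n ∩ F)) +
          dropEnergy s G (A n \ F))) atTop :=
        (liminf_const_add atTop _ _ (by isBoundedDefault) (by isBoundedDefault)).symm
    _ ≤ _ := by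
        refine liminf_le_liminf (Eventually.of_forall fun n => ?_)
        calc _ = (perimeter s F + perimeter s (A n \ F)) +
              (kernelMeasure G ((A n ∩ F) ×ˢ (A n ∩ F)) +
                kernelMeasure G ((A n \ F) ×ˢ (A n \ F))) := by
              rw [dropEnergy]
              ring
          _ ≤ (perimeter s (A n) + 2 * kernelMeasure (powerKernel N s) (defectPairs F (A n))) +
              kernelMeasure G (A n ×ˢ A n) :=
              add_le_add (perimeter_add_perimeter_diff_le s hF)
                (kernelMeasure_inter_add_diff_le G (hA n) hF)
          _ = dropEnergy s G (A n) +
                2 * kernelMeasure (powerKernel N s) (defectPairs F (A n)) := by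
              rw [dropEnergy]
              ring

end Convergence

/-! ### Sets moving apart and subadditivity -/

theorem exists_volume_diff_ball_le {A : Set (Space N)} (hA : MeasurableSet A)
    (hA' : volume A ≠ ∞) {ε : ℝ≥0∞} (hε : 0 < ε) :
    ∃ R : ℝ, volume (A \ Metric.ball 0 R) ≤ ε := by
  have h : Tendsto (fun n : ℕ => volume (A \ Metric.ball (0 : Space N) n)) atTop
      (𝓝 (volume (∅ : Set (Space N)))) := by
    refine tendsto_measure_of_ae_eventually (fun n => hA.diff measurableSet_ball)
      MeasurableSet.empty hA hA' (fun n => Set.sdiff_subset) (ae_of_all _ fun x => ?_)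
    obtain ⟨K, hK⟩ := exists_nat_gt ‖x‖
    filter_upwards [eventually_ge_atTop K] with n hn
    simp only [Set.mem_empty_iff_false, iff_false]
    refine fun hx => hx.2 (mem_ball_zero_iff.2 (hK.trans_le ?_))
    exact_mod_cast hn
  rw [measure_empty] at h
  obtain ⟨n, hn⟩ := (ENNReal.tendsto_nhds_zero.1 h ε hε).exists
  exact ⟨n, hn⟩

theorem exists_volume_inter_translate_le {A B : Set (Space N)} (hA : MeasurableSet A)
    (hB : MeasurableSet B) (hA' : volume A ≠ ∞) (hB' : volume B ≠ ∞) {ε : ℝ≥0∞} (hε : 0 < ε) :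
    ∃ R : ℝ, ∀ v : Space N, R ≤ ‖v‖ → volume (A ∩ translate v B) ≤ ε := by
  obtain ⟨R₁, h₁⟩ := exists_volume_diff_ball_le hA hA' (ENNReal.half_pos hε.ne')
  obtain ⟨R₂, h₂⟩ := exists_volume_diff_ball_le hB hB' (ENNReal.half_pos hε.ne')
  refine ⟨R₁ + R₂, fun v hv => ?_⟩
  calc volume (A ∩ translate v B)
      ≤ volume (A \ Metric.ball 0 R₁) + volume (translate v (B \ Metric.ball 0 R₂)) := by
        refine (measure_mono ?_).trans (measure_union_le _ _)
        rintro x ⟨hxA, hxB⟩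
        by_contra hcon
        simp only [Set.mem_union, Set.mem_sdiff, translate, Set.mem_preimage, mem_ball_zero_iff,
          not_or, not_and, not_not] at hcon hxB
        have h3 := hcon.1 hxA
        have h4 := hcon.2 hxB
        have h5 := norm_sub_le x (x - v)
        rw [sub_sub_cancel] at h5
        linarith
    _ ≤ ε / 2 + ε / 2 := by
        rw [volume_translate]
        exact add_le_add h₁ h₂
    _ = ε := ENNReal.add_halves ε

/-- The interaction of two sets of finite volume vanishes as they move apart. -/
theorem tendsto_kernelMeasure_prod_translate {G : Space N → ℝ≥0∞} (hG : IsRieszKernel G)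
    {A B : Set (Space N)} (hA : MeasurableSet A) (hB : MeasurableSet B)
    (hA' : volume A ≠ ∞) (hB' : volume B ≠ ∞) :
    Tendsto (fun v => kernelMeasure G (A ×ˢ translate v B)) (Bornology.cobounded (Space N))
      (𝓝 0) := by
  rw [ENNReal.tendsto_nhds_zero]
  intro ε hε
  have hε2 := (ENNReal.half_pos hε.ne').ne'
  obtain ⟨a, ha, haε⟩ := ENNReal.exists_nnreal_pos_mul_lt
    (ENNReal.mul_ne_top hA' hB') hε2
  obtain ⟨R, hR⟩ := hG.vanishing a (by exact_mod_cast ha)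
  obtain ⟨b, hb, hbε⟩ := ENNReal.exists_nnreal_pos_mul_lt
    (hG.lintegral_ball_lt_top R).ne hε2
  obtain ⟨ρ, hρ⟩ := exists_volume_inter_translate_le hA hB hA' hB' (ε := b) (by exact_mod_cast hb)
  have hlarge : ∀ᶠ v in Bornology.cobounded (Space N), ρ + R ≤ ‖v‖ :=
    tendsto_norm_cobounded_atTop.eventually_ge_atTop _
  filter_upwards [hlarge] with v hv
  have hBv := measurableSet_translate v hB
  have hφm := measurable_volume_inter_shift hA hBv
  have hconst : ∫⁻ z, (a : ℝ≥0∞) * volume (A ∩ (fun y => y + z) ⁻¹' translate v B) =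
      a * (volume A * volume B) := by
    have h1 := kernelMeasure_prod_eq_lintegral (k := fun _ => (a : ℝ≥0∞)) measurable_const hA hBv
    rw [kernelMeasure_prod measurable_const hA hBv] at h1
    rw [← h1, setLIntegral_const, setLIntegral_const, volume_translate]
    ring
  -- For differences outside the ball of radius `R` the kernel is at most `a`. For those inside, the
  -- slice is the overlap of `A` with a translate of `B` by at least `ρ`, of volume at most `b`.
  have hpt : ∀ᵐ z, G z * volume (A ∩ (fun y => y + z) ⁻¹' translate v B) ≤
      a * volume (A ∩ (fun y => y + z) ⁻¹' translate v B) +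
        b * (Metric.ball (0 : Space N) R).indicator G z := by
    filter_upwards [hR] with z hz
    by_cases hzR : z ∈ Metric.ball (0 : Space N) R
    · rw [Set.indicator_of_mem hzR]
      refine le_add_left ?_
      rw [mul_comm]
      gcongr
      have hset : (fun y => y + z) ⁻¹' translate v B = translate (v - z) B := by
        ext y
        simp [translate, sub_sub_eq_add_sub]
      rw [hset]
      refine hρ _ ?_
      have := norm_sub_norm_le v z
      rw [mem_ball_zero_iff] at hzR
      linarith
    · refine le_add_right ?_
      gcongr
      exact hz (by simpa using hzR)
  calc kernelMeasure G (A ×ˢ translate v B)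
      = ∫⁻ z, G z * volume (A ∩ (fun y => y + z) ⁻¹' translate v B) :=
        kernelMeasure_prod_eq_lintegral hG.measurable hA hBv
    _ ≤ a * (volume A * volume B) + b * ∫⁻ z in Metric.ball 0 R, G z := by
        refine (lintegral_mono_ae hpt).trans_eq ?_
        rw [lintegral_add_left (hφm.const_mul _), hconst,
          lintegral_const_mul' _ _ ENNReal.coe_ne_top, lintegral_indicator measurableSet_ball]
    _ ≤ ε / 2 + ε / 2 := add_le_add haε.le hbε.le
    _ = ε := ENNReal.add_halves ε

theorem dropEnergy_union_le (s : ℝ) {G : Space N → ℝ≥0∞} (hG : IsRieszKernel G)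
    {A B : Set (Space N)} (hA : MeasurableSet A) (hB : MeasurableSet B) :
    dropEnergy s G (A ∪ B) ≤
      dropEnergy s G A + dropEnergy s G B + 2 * kernelMeasure G (A ×ˢ B) := by
  have h1 : perimeter s (A ∪ B) ≤ perimeter s A + perimeter s B := by
    refine (measure_mono ?_).trans (measure_union_le _ _)
    rintro ⟨x, y⟩ ⟨hx | hx, hy⟩
    · exact Or.inl ⟨hx, fun h => hy (Or.inl h)⟩
    · exact Or.inr ⟨hx, fun h => hy (Or.inr h)⟩
  have h2 : kernelMeasure G ((A ∪ B) ×ˢ (A ∪ B)) ≤ (kernelMeasure G (A ×ˢ A) +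
      kernelMeasure G (B ×ˢ B)) + (kernelMeasure G (A ×ˢ B) + kernelMeasure G (B ×ˢ A)) := by
    refine (measure_mono (t := (A ×ˢ A ∪ B ×ˢ B) ∪ (A ×ˢ B ∪ B ×ˢ A)) ?_).trans
      ((measure_union_le _ _).trans (add_le_add (measure_union_le _ _) (measure_union_le _ _)))
    rintro ⟨x, y⟩ ⟨hx, hy⟩
    simp only [Set.mem_union, Set.mem_prod] at *
    tauto
  rw [kernelMeasure_prod_comm hG.measurable hG.even hB hA, ← two_mul] at h2
  calc dropEnergy s G (A ∪ B) ≤ _ := add_le_add h1 h2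
    _ = _ := by
      rw [dropEnergy, dropEnergy]
      ring

/-- The infimum of the energy at fixed volume. -/
noncomputable def dropInf (s : ℝ) (G : Space N → ℝ≥0∞) (t : ℝ≥0∞) : ℝ≥0∞ :=
  ⨅ A : {A : Set (Space N) // MeasurableSet A ∧ volume A = t}, dropEnergy s G A

theorem dropInf_le (s : ℝ) (G : Space N → ℝ≥0∞) {A : Set (Space N)} (hA : MeasurableSet A)
    {t : ℝ≥0∞} (ht : volume A = t) : dropInf s G t ≤ dropEnergy s G A :=
  iInf_le (fun A : {A : Set (Space N) // MeasurableSet A ∧ volume A = t} =>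
    dropEnergy s G (A : Set (Space N))) ⟨A, hA, ht⟩

theorem dropInf_lt_top (hN : 0 < N) {s : ℝ} (hs0 : 0 < s) (hs1 : s < 1)
    {G : Space N → ℝ≥0∞} (hG : IsRieszKernel G) {t : ℝ≥0∞} (ht : t ≠ ∞) :
    dropInf s G t < ∞ := by
  obtain ⟨A, hA, hAt, hfin⟩ := exists_dropEnergy_lt_top hN hs0 hs1 hG ht
  exact (dropInf_le s G hA hAt).trans_lt hfin

/-- Dilation changes the volume by a factor `c` and the energy at most by a factor `c²`. -/
theorem dropInf_mul_le (hN : 0 < N) {s : ℝ} (hs : 0 < s) {G : Space N → ℝ≥0∞}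
    (hG : IsRieszKernel G) {c : ℝ≥0∞} (hc1 : 1 ≤ c) (hc : c ≠ ∞) {A : Set (Space N)}
    (hA : MeasurableSet A) : dropInf s G (c * volume A) ≤ c ^ 2 * dropEnergy s G A := by
  have hc1' : 1 ≤ c.toReal := by
    simpa using ENNReal.toReal_mono hc hc1
  have hpow : ENNReal.ofReal ((c.toReal ^ ((N : ℝ)⁻¹)) ^ N) = c := by
    rw [Real.rpow_inv_natCast_pow (by linarith) hN.ne', ENNReal.ofReal_toReal hc]
  have h1 : 1 ≤ c.toReal ^ ((N : ℝ)⁻¹) := Real.one_le_rpow hc1' (by positivity)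
  have h2 := dropEnergy_dilate_le hs hG hA h1
  rw [hpow] at h2
  refine (dropInf_le s G (measurableSet_dilate _ hA) ?_).trans h2
  rw [volume_dilate (by linarith), hpow]

theorem dropInf_mul_le_mul (hN : 0 < N) {s : ℝ} (hs : 0 < s) {G : Space N → ℝ≥0∞}
    (hG : IsRieszKernel G) {c : ℝ≥0∞} (hc1 : 1 ≤ c) (hc : c ≠ ∞) (t : ℝ≥0∞) :
    dropInf s G (c * t) ≤ c ^ 2 * dropInf s G t := by
  have hc2 : c ^ 2 ≠ ∞ := ENNReal.pow_ne_top hc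
  rw [dropInf.eq_1 s G t, ENNReal.mul_iInf_of_ne (pow_ne_zero _ (by positivity)) hc2]
  refine le_iInf fun A => ?_
  have := dropInf_mul_le hN hs hG hc1 hc A.2.1
  rwa [A.2.2] at this

/-- As `v → ∞`, the interaction of `A` with `translate v B` and the volume of their overlap tend to
`0`. Dilating the union back to the full volume costs the square of a volume ratio tending to `1`.
-/
theorem dropInf_add_le_dropEnergy (hN : 0 < N) {s : ℝ} (hs : 0 < s) {G : Space N → ℝ≥0∞}
    (hG : IsRieszKernel G) {A B : Set (Space N)} (hA : MeasurableSet A) (hB : MeasurableSet B)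
    (hA' : volume A ≠ ∞) (hB' : volume B ≠ ∞) :
    dropInf s G (volume A + volume B) ≤ dropEnergy s G A + dropEnergy s G B := by
  -- Makes the filter `cobounded` nontrivial, as passing to the limit requires.
  have := nontrivial_space hN
  rcases eq_or_ne (volume A + volume B) 0 with h0 | h0
  · rw [h0]
    refine (dropInf_le s G MeasurableSet.empty measure_empty).trans ?_
    rw [dropEnergy_empty]
    exact zero_le
  set M := volume A + volume B with hM
  have hMtop : M ≠ ∞ := ENNReal.add_ne_top.2 ⟨hA', hB'⟩
  set l := Bornology.cobounded (Space N)
  have hinter : Tendsto (fun v => volume (A ∩ translate v B)) l (𝓝 0) := by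
    rw [ENNReal.tendsto_nhds_zero]
    intro ε hε
    obtain ⟨R, hR⟩ := exists_volume_inter_translate_le hA hB hA' hB' hε
    filter_upwards [(tendsto_norm_cobounded_atTop (E := Space N)).eventually_ge_atTop R]
      with v hv using hR v hv
  have hvol : ∀ v, volume (A ∪ translate v B) = M - volume (A ∩ translate v B) := by
    intro v
    refine ENNReal.eq_sub_of_add_eq ?_ ?_
    · exact ne_top_of_le_ne_top hA' (measure_mono Set.inter_subset_left)
    · rw [measure_union_add_inter _ (measurableSet_translate v hB), volume_translate]
  have hvlim : Tendsto (fun v => volume (A ∪ translate v B)) l (𝓝 M) := by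
    simp_rw [hvol]
    simpa using ENNReal.Tendsto.sub (tendsto_const_nhds (x := M)) hinter (Or.inl hMtop)
  have hratio : Tendsto (fun v => (M / volume (A ∪ translate v B)) ^ 2) l (𝓝 1) := by
    have h1 := ENNReal.Tendsto.div (tendsto_const_nhds (x := M)) (Or.inl h0) hvlim (Or.inl hMtop)
    rw [ENNReal.div_self h0 hMtop] at h1
    simpa using ENNReal.Tendsto.pow (n := 2) h1
  have hE : Tendsto (fun v => dropEnergy s G A + dropEnergy s G B +
      2 * kernelMeasure G (A ×ˢ translate v B)) l (𝓝 (dropEnergy s G A + dropEnergy s G B)) := by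
    have h1 := ENNReal.Tendsto.const_mul (a := 2)
      (tendsto_kernelMeasure_prod_translate hG hA hB hA' hB') (Or.inr (by simp))
    simpa using (tendsto_const_nhds (x := dropEnergy s G A + dropEnergy s G B)).add h1
  have hprod := ENNReal.Tendsto.mul hratio (Or.inl one_ne_zero) hE (Or.inr ENNReal.one_ne_top)
  rw [one_mul] at hprod
  refine ge_of_tendsto hprod ?_
  filter_upwards [hvlim.eventually_ne h0] with v hv
  have hUm := hA.union (measurableSet_translate v hB)
  have hUle : volume (A ∪ translate v B) ≤ M := (hvol v).le.trans tsub_le_self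
  have hUtop := ne_top_of_le_ne_top hMtop hUle
  have h3 := dropInf_mul_le hN hs hG (c := M / volume (A ∪ translate v B))
    (by rwa [ENNReal.le_div_iff_mul_le (Or.inl hv) (Or.inl hUtop), one_mul])
    (ENNReal.div_ne_top hMtop hv) hUm
  rw [ENNReal.div_mul_cancel hv hUtop] at h3
  refine h3.trans (mul_le_mul_right ?_ _)
  have h4 := dropEnergy_union_le s hG hA (measurableSet_translate v hB)
  rwa [dropEnergy_translate hG.measurable hB] at h4

theorem dropInf_add_le (hN : 0 < N) {s : ℝ} (hs : 0 < s) {G : Space N → ℝ≥0∞}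
    (hG : IsRieszKernel G) {a b : ℝ≥0∞} (ha : a ≠ ∞) (hb : b ≠ ∞) :
    dropInf s G (a + b) ≤ dropInf s G a + dropInf s G b := by
  rw [dropInf.eq_1 s G a, ENNReal.iInf_add]
  refine le_iInf fun A => ?_
  rw [dropInf.eq_1 s G b, ENNReal.add_iInf]
  refine le_iInf fun B => ?_
  have := dropInf_add_le_dropEnergy hN hs hG A.2.1 B.2.1 (by rwa [A.2.2]) (by rwa [B.2.2])
  rwa [A.2.2, B.2.2] at this

theorem dropInf_zero (s : ℝ) (G : Space N → ℝ≥0∞) : dropInf s G 0 = 0 := by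
  refine le_antisymm ?_ zero_le
  exact (dropInf_le s G MeasurableSet.empty measure_empty).trans (dropEnergy_empty s G).le

theorem dropInf_sum_le (hN : 0 < N) {s : ℝ} (hs : 0 < s) {G : Space N → ℝ≥0∞}
    (hG : IsRieszKernel G) {ι : Type*} (S : Finset ι) {A : ι → Set (Space N)}
    (hA : ∀ i, MeasurableSet (A i)) (hA' : ∀ i, volume (A i) ≠ ∞) :
    dropInf s G (∑ i ∈ S, volume (A i)) ≤ ∑ i ∈ S, dropEnergy s G (A i) := by
  classical
  induction S using Finset.induction_on with
  | empty => simp [dropInf_zero]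
  | insert i S hi ih =>
    rw [Finset.sum_insert hi, Finset.sum_insert hi]
    refine (dropInf_add_le hN hs hG (hA' i) (ENNReal.sum_ne_top.2 fun j _ => hA' j)).trans ?_
    exact add_le_add (dropInf_le s G (hA i) rfl) ih

/-! ### The relaxed infimum -/

/-- The lower semicontinuous envelope of the infimum of the energy as a function of the volume. -/
noncomputable def relaxedInf (s : ℝ) (G : Space N → ℝ≥0∞) (t : ℝ≥0∞) : ℝ≥0∞ :=
  liminf (dropInf s G) (𝓝 t)

theorem relaxedInf_le_dropInf (s : ℝ) (G : Space N → ℝ≥0∞) (t : ℝ≥0∞) :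
    relaxedInf s G t ≤ dropInf s G t :=
  -- The neighbourhoods are not punctured, so the value at `t` itself competes.
  liminf_le_of_frequently_le' fun h => h.self_of_nhds le_rfl

theorem relaxedInf_le_liminf (s : ℝ) (G : Space N → ℝ≥0∞) {ι : Type*} {f : Filter ι}
    {u : ι → ℝ≥0∞} {t : ℝ≥0∞} (hu : Tendsto u f (𝓝 t)) :
    relaxedInf s G t ≤ liminf (fun i => dropInf s G (u i)) f := by
  rw [relaxedInf, ← Function.comp_def, liminf_comp]
  exact liminf_le_liminf_of_le hu

theorem exists_tendsto_relaxedInf (s : ℝ) (G : Space N → ℝ≥0∞) (t : ℝ≥0∞) :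
    ∃ u : ℕ → ℝ≥0∞, Tendsto u atTop (𝓝 t) ∧
      Tendsto (fun n => dropInf s G (u n)) atTop (𝓝 (relaxedInf s G t)) := by
  obtain ⟨u, hu, hu'⟩ := exists_seq_tendsto_liminf (f := 𝓝 t) (u := dropInf s G)
  exact ⟨u, hu', hu⟩

theorem relaxedInf_add_le (hN : 0 < N) {s : ℝ} (hs : 0 < s) {G : Space N → ℝ≥0∞}
    (hG : IsRieszKernel G) {a b : ℝ≥0∞} (ha : a ≠ ∞) (hb : b ≠ ∞) :
    relaxedInf s G (a + b) ≤ relaxedInf s G a + relaxedInf s G b := by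
  obtain ⟨u, hu, hu'⟩ := exists_tendsto_relaxedInf s G a
  obtain ⟨v, hv, hv'⟩ := exists_tendsto_relaxedInf s G b
  refine (relaxedInf_le_liminf s G (hu.add hv)).trans ?_
  rw [← (hu'.add hv').liminf_eq]
  refine liminf_le_liminf ?_
  filter_upwards [hu.eventually_ne ha, hv.eventually_ne hb] with n h1 h2
  exact dropInf_add_le hN hs hG h1 h2

theorem relaxedInf_mul_le (hN : 0 < N) {s : ℝ} (hs : 0 < s) {G : Space N → ℝ≥0∞}
    (hG : IsRieszKernel G) {c : ℝ≥0∞} (hc1 : 1 ≤ c) (hc : c ≠ ∞) (t : ℝ≥0∞) :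
    relaxedInf s G (c * t) ≤ c ^ 2 * relaxedInf s G t := by
  obtain ⟨u, hu, hu'⟩ := exists_tendsto_relaxedInf s G t
  refine (relaxedInf_le_liminf s G (ENNReal.Tendsto.const_mul hu (Or.inr hc))).trans ?_
  rw [← (ENNReal.Tendsto.const_mul hu' (Or.inr (ENNReal.pow_ne_top hc))).liminf_eq]
  exact liminf_le_liminf (Eventually.of_forall fun n => dropInf_mul_le_mul hN hs hG hc1 hc _)

/-- The superlinear lower bound for small sets is open in the volume, so it survives relaxation. It
is what excludes small pieces. -/
theorem exists_mul_le_relaxedInf (hN : 0 < N) {s : ℝ} (hs : 0 < s) (G : Space N → ℝ≥0∞)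
    {L : ℝ≥0∞} (hL : L ≠ ∞) : ∃ δ : ℝ≥0∞, 0 < δ ∧ ∀ t < δ, L * t ≤ relaxedInf s G t := by
  obtain ⟨δ, hδ, h⟩ := exists_mul_volume_le_perimeter (N := N) hN hs hL
  refine ⟨δ, hδ, fun t ht => ?_⟩
  rw [← (ENNReal.Tendsto.const_mul (tendsto_id (x := 𝓝 t)) (Or.inr hL)).liminf_eq]
  refine liminf_le_liminf ?_
  filter_upwards [eventually_lt_nhds ht] with u hu
  refine le_iInf fun A => ?_
  have h1 := h A A.2.1 (A.2.2.trans_le hu.le)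
  rw [A.2.2] at h1
  exact h1.trans (perimeter_le_dropEnergy s G _)

theorem relaxedInf_lt_top (hN : 0 < N) {s : ℝ} (hs0 : 0 < s) (hs1 : s < 1)
    {G : Space N → ℝ≥0∞} (hG : IsRieszKernel G) {t : ℝ≥0∞} (ht : t ≠ ∞) :
    relaxedInf s G t < ∞ :=
  (relaxedInf_le_dropInf s G t).trans_lt (dropInf_lt_top hN hs0 hs1 hG ht)

/-! ### Splitting off pieces and finiteness -/

theorem translate_inter_ball (y : Space N) (ρ : ℝ) (A : Set (Space N)) :
    translate (-y) A ∩ Metric.ball 0 ρ = translate (-y) (A ∩ Metric.ball y ρ) := by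
  ext x
  simp [translate]

/-- Almost minimizing sets for the relaxed problem, translated so that they do not vanish. -/
theorem exists_concentrated_minimizing_seq (hN : 0 < N) {s : ℝ} (hs0 : 0 < s) (hs1 : s < 1)
    {G : Space N → ℝ≥0∞} (hG : IsRieszKernel G) {m : ℝ≥0∞} (hm : m ≠ 0) (hm' : m ≠ ∞) :
    ∃ (A : ℕ → Set (Space N)) (w : ℕ → ℝ≥0∞) (ρ : ℝ), 0 < ρ ∧ (∀ n, MeasurableSet (A n)) ∧
      Tendsto (fun n => volume (A n)) atTop (𝓝 m) ∧
      Tendsto w atTop (𝓝 (relaxedInf s G m)) ∧ (∀ n, dropEnergy s G (A n) ≤ w n) ∧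
      (∀ n, w n ≤ relaxedInf s G m + 2) ∧
      ∀ n, volume (Metric.ball (0 : Space N) ρ) / 2 ≤ volume (A n ∩ Metric.ball 0 ρ) := by
  have hr := relaxedInf_lt_top hN hs0 hs1 hG hm'
  obtain ⟨u, hu, hu'⟩ := exists_tendsto_relaxedInf s G m
  have hm2 : m / 2 < m := ENNReal.half_lt_self hm hm'
  -- Beyond `K` the volume exceeds `m / 2` and the infimum is within `1` of its limit; the slack `1
  -- / (n + 1)` accounts for the rest of the bound `relaxedInf s G m + 2`.
  obtain ⟨K, hK⟩ := eventually_atTop.1 ((hu.eventually (lt_mem_nhds hm2)).and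
    (hu'.eventually (gt_mem_nhds (ENNReal.lt_add_right hr.ne one_ne_zero))))
  have hex : ∀ n : ℕ, ∃ A : Set (Space N), MeasurableSet A ∧ volume A = u (n + K) ∧
      dropEnergy s G A ≤ dropInf s G (u (n + K)) + ((n : ℝ≥0∞) + 1)⁻¹ := by
    intro n
    have hlt : dropInf s G (u (n + K)) < dropInf s G (u (n + K)) + ((n : ℝ≥0∞) + 1)⁻¹ :=
      ENNReal.lt_add_right (((hK (n + K) (by lia)).2.trans_le le_top).ne) (by simp)
    obtain ⟨A, hA⟩ := iInf_lt_iff.1 hlt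
    exact ⟨A, A.2.1, A.2.2, hA.le⟩
  choose A hAm hAv hAE using hex
  have hwb : ∀ n : ℕ, dropInf s G (u (n + K)) + ((n : ℝ≥0∞) + 1)⁻¹ ≤ relaxedInf s G m + 2 := by
    intro n
    rw [← one_add_one_eq_two, ← add_assoc]
    refine add_le_add (hK (n + K) (by lia)).2.le ?_
    simp
  obtain ⟨ρ, hρ, hconc⟩ := exists_concentration (N := N) hN hs0 (v := m / 2)
    (C := relaxedInf s G m + 2) (ENNReal.half_pos hm) hm2.ne_top
    (ENNReal.add_ne_top.2 ⟨hr.ne, by simp⟩)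
  have hex2 : ∀ n, ∃ y, volume (Metric.ball (0 : Space N) ρ) / 2 <
      volume (A n ∩ Metric.ball y ρ) := fun n => hconc (A n) (hAm n)
    ((hK (n + K) (by lia)).1.le.trans_eq (hAv n).symm)
    ((perimeter_le_dropEnergy s G _).trans ((hAE n).trans (hwb n)))
  choose y hy using hex2
  have hinv : Tendsto (fun n : ℕ => ((n : ℝ≥0∞) + 1)⁻¹) atTop (𝓝 0) := by
    have := (tendsto_add_atTop_iff_nat 1).2 ENNReal.tendsto_inv_nat_nhds_zero
    simpa using this
  refine ⟨fun n => translate (-y n) (A n),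
    fun n => dropInf s G (u (n + K)) + ((n : ℝ≥0∞) + 1)⁻¹, ρ, hρ,
    fun n => measurableSet_translate _ (hAm n), ?_, ?_, ?_, hwb, ?_⟩
  · simp_rw [volume_translate, hAv]
    exact (tendsto_add_atTop_iff_nat K).2 hu
  · simpa using ((tendsto_add_atTop_iff_nat K).2 hu').add hinv
  · intro n
    rw [dropEnergy_translate hG.measurable (hAm n)]
    exact hAE n
  · intro n
    rw [translate_inter_ball, volume_translate]
    exact (hy n).le

/-- A set of positive volume can be split off from the relaxed problem without loss. -/
theorem exists_split (hN : 0 < N) {s : ℝ} (hs0 : 0 < s) (hs1 : s < 1)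
    {G : Space N → ℝ≥0∞} (hG : IsRieszKernel G) {m : ℝ≥0∞} (hm : m ≠ 0) (hm' : m ≠ ∞) :
    ∃ E : Set (Space N), MeasurableSet E ∧ 0 < volume E ∧ volume E ≤ m ∧
      dropEnergy s G E + relaxedInf s G (m - volume E) ≤ relaxedInf s G m := by
  obtain ⟨B, w, ρ, hρ, hBm, hBv, hw, hBw, hwb, hBρ⟩ :=
    exists_concentrated_minimizing_seq hN hs0 hs1 hG hm hm'
  have hC : relaxedInf s G m + 2 ≠ ∞ :=
    ENNReal.add_ne_top.2 ⟨(relaxedInf_lt_top hN hs0 hs1 hG hm').ne, by simp⟩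
  have hBP : ∀ n, perimeter s (B n) ≤ relaxedInf s G m + 2 := fun n =>
    (perimeter_le_dropEnergy s G _).trans ((hBw n).trans (hwb n))
  obtain ⟨φ, hφ, F, hF, hconv⟩ := exists_subseq_ae_eventually_mem_iff hN hs0 hBm hC hBP
  have hφt := hφ.tendsto_atTop
  have hDm : ∀ n, MeasurableSet (B (φ n)) := fun n => hBm _
  have hDv : Tendsto (fun n => volume (B (φ n))) atTop (𝓝 m) := hBv.comp hφt
  have hFle : volume F ≤ m :=
    (measure_le_liminf_of_ae_eventually hDm hF hconv).trans_eq hDv.liminf_eq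
  have hFtop : volume F ≠ ∞ := ne_top_of_le_ne_top hm' hFle
  have hFpos : 0 < volume F := by
    -- Volume in a fixed ball passes to the limit, so the concentrated mass is inherited by `F`.
    have h1 : Tendsto (fun n => volume (B (φ n) ∩ Metric.ball (0 : Space N) ρ)) atTop
        (𝓝 (volume (F ∩ Metric.ball 0 ρ))) := by
      refine tendsto_measure_of_ae_eventually (fun n => (hDm n).inter measurableSet_ball)
        (hF.inter measurableSet_ball) measurableSet_ball measure_ball_lt_top.ne
        (fun n => Set.inter_subset_right) ?_
      filter_upwards [hconv] with x hx
      filter_upwards [hx] with n hn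
      simp [hn]
    have h2 := ge_of_tendsto' h1 fun n => hBρ (φ n)
    exact (ENNReal.half_pos (Metric.measure_ball_pos volume _ hρ).ne').trans_le
      (h2.trans (measure_mono Set.inter_subset_left))
  have hPF : perimeter s F ≠ ∞ := by
    refine ne_top_of_le_ne_top hC ((perimeter_le_liminf s hDm hF hconv).trans ?_)
    exact liminf_le_of_frequently_le' (Frequently.of_forall fun n => hBP (φ n))
  -- The volume of the remainder converges to `m - volume F` without having to equal it, which
  -- suffices for `relaxedInf`.
  have hdiff : Tendsto (fun n => volume (B (φ n) \ F)) atTop (𝓝 (m - volume F)) := by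
    have h1 : Tendsto (fun n => volume (B (φ n) ∩ F)) atTop (𝓝 (volume F)) := by
      refine tendsto_measure_of_ae_eventually (fun n => (hDm n).inter hF) hF hF hFtop
        (fun n => Set.inter_subset_right) ?_
      filter_upwards [hconv] with x hx
      filter_upwards [hx] with n hn
      simp [hn]
    refine (ENNReal.Tendsto.sub hDv h1 (Or.inl hm')).congr fun n => ?_
    refine (ENNReal.eq_sub_of_add_eq ?_ ?_).symm
    · exact ne_top_of_le_ne_top hFtop (measure_mono Set.inter_subset_right)
    · rw [add_comm, measure_inter_add_sdiff _ hF]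
  refine ⟨F, hF, hFpos, hFle, ?_⟩
  calc dropEnergy s G F + relaxedInf s G (m - volume F)
      ≤ dropEnergy s G F + liminf (fun n => dropEnergy s G (B (φ n) \ F)) atTop := by
        refine add_le_add_right ((relaxedInf_le_liminf s G hdiff).trans ?_) _
        exact liminf_le_liminf (Eventually.of_forall fun n =>
          dropInf_le s G ((hDm n).diff hF) rfl)
    _ ≤ liminf (fun n => dropEnergy s G (B (φ n))) atTop :=
        dropEnergy_add_liminf_diff_le s G hDm hF hPF hconv
    _ ≤ liminf (fun n => w (φ n)) atTop :=
        liminf_le_liminf (Eventually.of_forall fun n => hBw (φ n))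
    _ = relaxedInf s G m := (hw.comp hφt).liminf_eq

/-- A volume which is split off without loss cannot be too small. -/
theorem exists_le_of_split (hN : 0 < N) {s : ℝ} (hs0 : 0 < s) (hs1 : s < 1)
    {G : Space N → ℝ≥0∞} (hG : IsRieszKernel G) {m : ℝ≥0∞} (hm : m ≠ 0) (hm' : m ≠ ∞) :
    ∃ c : ℝ≥0∞, 0 < c ∧ c ≠ ∞ ∧ ∀ a, 0 < a → a ≤ m →
      relaxedInf s G a + relaxedInf s G (m - a) ≤ relaxedInf s G m → c ≤ a := by
  have hr : ∀ {t : ℝ≥0∞}, t ≠ ∞ → relaxedInf s G t ≠ ∞ :=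
    fun ht => (relaxedInf_lt_top hN hs0 hs1 hG ht).ne
  -- Write `R`, `P` for the relaxed infima at `m`, `a`. Scaling gives `R ≤ (m / (m - a)) ^ 2 * (R -
  -- P)`, hence `P ≤ 2 * R * a / m`; the extra `1` in `L` makes this contradictory for small `a >
  -- 0`.
  obtain ⟨δ, hδ, hδL⟩ := exists_mul_le_relaxedInf hN hs0 G
    (L := 2 * relaxedInf s G m / m + 1) (ENNReal.add_ne_top.2
      ⟨ENNReal.div_ne_top (ENNReal.mul_ne_top (by simp) (hr hm')) hm, by simp⟩)
  refine ⟨min δ m, lt_min hδ hm.bot_lt, (min_lt_of_right_lt hm'.lt_top).ne,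
    fun a ha0 ham hsplit => ?_⟩
  by_contra! hlt
  have haδ : a < δ := hlt.trans_le (min_le_left _ _)
  have ham' : a < m := hlt.trans_le (min_le_right _ _)
  have ha : a ≠ ∞ := ham'.ne_top
  have hb0 : m - a ≠ 0 := (tsub_pos_of_lt ham').ne'
  have hb : m - a ≠ ∞ := ENNReal.sub_ne_top hm'
  have hscale := relaxedInf_mul_le hN hs0 hG (c := m / (m - a))
    (by
      rw [ENNReal.le_div_iff_mul_le (Or.inl hb0) (Or.inl hb), one_mul]
      exact tsub_le_self) (ENNReal.div_ne_top hm' hb0) (m - a)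
  rw [ENNReal.div_mul_cancel hb0 hb] at hscale
  have hlow := hδL a haδ
  have e1 := ENNReal.toReal_mono (hr hm') hsplit
  have e2 := ENNReal.toReal_mono (ENNReal.mul_ne_top
    (ENNReal.pow_ne_top (ENNReal.div_ne_top hm' hb0)) (hr hb)) hscale
  have e3 := ENNReal.toReal_mono (hr ha) hlow
  rw [ENNReal.toReal_add (hr ha) (hr hb)] at e1
  rw [ENNReal.toReal_mul, ENNReal.toReal_pow, ENNReal.toReal_div,
    ENNReal.toReal_sub_of_le ham hm'] at e2
  rw [ENNReal.toReal_mul, ENNReal.toReal_add (ENNReal.div_ne_top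
    (ENNReal.mul_ne_top (by simp) (hr hm')) hm) (by simp), ENNReal.toReal_div,
    ENNReal.toReal_mul] at e3
  have hM : 0 < m.toReal := ENNReal.toReal_pos hm hm'
  have haR : 0 < a.toReal := ENNReal.toReal_pos ha0.ne' ha
  have hbR : 0 < m.toReal - a.toReal := by
    linarith [(ENNReal.toReal_lt_toReal ha hm').2 ham']
  have hR : 0 ≤ (relaxedInf s G m).toReal := ENNReal.toReal_nonneg
  generalize (relaxedInf s G m).toReal = R at *
  generalize (relaxedInf s G a).toReal = P at *
  generalize (relaxedInf s G (m - a)).toReal = Q at *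
  generalize m.toReal = M at *
  generalize a.toReal = x at *
  simp only [ENNReal.toReal_ofNat, ENNReal.toReal_one] at e3
  rw [div_pow, div_mul_eq_mul_div, le_div_iff₀ (by positivity)] at e2
  have e4 : (2 * R * M + M ^ 2) * x ≤ M ^ 2 * P := by
    calc _ = M ^ 2 * ((2 * R / M + 1) * x) := by
          field_simp
      _ ≤ _ := by gcongr
  have e5 : M ^ 2 * Q ≤ M ^ 2 * (R - P) := by
    gcongr
    linarith
  nlinarith [mul_pos (pow_pos hM 2) haR, mul_nonneg hR (sq_nonneg x)]

/-- The relaxed problem is solved by finitely many sets. -/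
theorem exists_finite_family (hN : 0 < N) {s : ℝ} (hs0 : 0 < s) (hs1 : s < 1)
    {G : Space N → ℝ≥0∞} (hG : IsRieszKernel G) {m : ℝ≥0∞} (hm : m ≠ 0) (hm' : m ≠ ∞) :
    ∃ (M : ℕ) (A : ℕ → Set (Space N)), (∀ k, M ≤ k → A k = ∅) ∧ (∀ k, MeasurableSet (A k)) ∧
      ∑ k ∈ Finset.range M, volume (A k) = m ∧
      ∑ k ∈ Finset.range M, dropEnergy s G (A k) ≤ relaxedInf s G m := by
  obtain ⟨c, hc, hc', hcm⟩ := exists_le_of_split hN hs0 hs1 hG hm hm'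
  -- The induction carries along that `t` splits off from the fixed volume `m` without loss. Each
  -- piece then also splits off from `m`, so one bound `c` serves for all pieces.
  have key : ∀ n : ℕ, ∀ t ≤ m, relaxedInf s G t + relaxedInf s G (m - t) ≤ relaxedInf s G m →
      t ≤ n * c → ∃ (M : ℕ) (A : ℕ → Set (Space N)), (∀ k, M ≤ k → A k = ∅) ∧
        (∀ k, MeasurableSet (A k)) ∧ ∑ k ∈ Finset.range M, volume (A k) = t ∧
        ∑ k ∈ Finset.range M, dropEnergy s G (A k) ≤ relaxedInf s G t := by
    intro n
    induction n with
    | zero =>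
      intro t _ _ htn
      have ht0 : t = 0 := by simpa using htn
      exact ⟨0, fun _ => ∅, fun _ _ => rfl, fun _ => MeasurableSet.empty, by simp [ht0], by simp⟩
    | succ n ih =>
      intro t htm hsplit htn
      have ht' : t ≠ ∞ := ne_top_of_le_ne_top hm' htm
      rcases eq_or_ne t 0 with ht0 | ht0
      · exact ⟨0, fun _ => ∅, fun _ _ => rfl, fun _ => MeasurableSet.empty, by simp [ht0], by simp⟩
      obtain ⟨E, hE, hE0, hEt, hEs⟩ := exists_split hN hs0 hs1 hG ht0 ht'
      set a := volume E with ha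
      have hat : a ≠ ∞ := ne_top_of_le_ne_top ht' hEt
      have hra : relaxedInf s G a ≤ dropEnergy s G E :=
        (relaxedInf_le_dropInf s G a).trans (dropInf_le s G hE rfl)
      have hchain : relaxedInf s G a + relaxedInf s G (t - a) + relaxedInf s G (m - t) ≤
          relaxedInf s G m :=
        (add_le_add_left ((add_le_add_left hra _).trans hEs) _).trans hsplit
      have hta : t - a ≠ ∞ := ENNReal.sub_ne_top ht'
      have hmt : m - t ≠ ∞ := ENNReal.sub_ne_top hm'
      have h1 : relaxedInf s G (m - a) ≤ relaxedInf s G (t - a) + relaxedInf s G (m - t) := by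
        have : m - a = (t - a) + (m - t) := by
          rw [add_comm, tsub_add_tsub_cancel htm hEt]
        rw [this]
        exact relaxedInf_add_le hN hs0 hG hta hmt
      have hca : c ≤ a := by
        refine hcm a hE0 (hEt.trans htm) ((add_le_add_right h1 _).trans ?_)
        rwa [← add_assoc]
      -- By subadditivity the removed piece is merged with what was already split off, so the rest
      -- `t - a` again splits off from `m` without loss.
      have h2 : relaxedInf s G (m - (t - a)) ≤ relaxedInf s G a + relaxedInf s G (m - t) := by
        have : m - (t - a) = a + (m - t) := by
          refine (ENNReal.eq_sub_of_add_eq hta ?_).symm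
          rw [add_comm a, add_assoc, add_tsub_cancel_of_le hEt, tsub_add_cancel_of_le htm]
        rw [this]
        exact relaxedInf_add_le hN hs0 hG hat hmt
      obtain ⟨M, A, hA0, hAm, hAv, hAE⟩ := ih (t - a) (tsub_le_self.trans htm)
        ((add_le_add_right h2 _).trans (le_trans (le_of_eq (by ring)) hchain))
        (by
          rw [tsub_le_iff_right]
          refine htn.trans ?_
          push_cast
          rw [add_mul, one_mul]
          gcongr)
      refine ⟨M + 1, fun k => Nat.casesOn k E A, ?_, ?_, ?_, ?_⟩
      · rintro (_ | k) hk
        · lia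
        · exact hA0 k (by lia)
      · rintro (_ | k)
        · exact hE
        · exact hAm k
      · rw [Finset.sum_range_succ']
        change ∑ k ∈ Finset.range M, volume (A k) + volume E = t
        rw [hAv, tsub_add_cancel_of_le hEt]
      · rw [Finset.sum_range_succ', add_comm]
        exact (add_le_add_right hAE _).trans hEs
  obtain ⟨n, hn⟩ : ∃ n : ℕ, m ≤ n * c := by
    obtain ⟨n, hn⟩ := ENNReal.exists_nat_mul_gt hc.ne' hm'
    exact ⟨n, hn.le⟩
  refine key n m le_rfl ?_ hn
  rw [tsub_self]
  have : relaxedInf s G 0 = 0 :=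
    le_antisymm ((relaxedInf_le_dropInf s G 0).trans (dropInf_zero s G).le) zero_le
  rw [this, add_zero]

/-! ### Transfer to the original kernel and to Lebesgue measurable sets -/

/-- A locally integrable kernel agrees almost everywhere with a measurable Riesz kernel. -/
theorem exists_isRieszKernel {g : Space N → ℝ} (hg_loc : LocallyIntegrable g volume)
    (hg1 : RadiallyNonincreasing g) (hg2 : SymmetricKernel g) (hg4 : VanishesAtInfinity g) :
    ∃ G : Space N → ℝ≥0∞, IsRieszKernel G ∧ ∀ᵐ z, G z = ENNReal.ofReal (g z) := by
  have hae : AEMeasurable g volume := hg_loc.aestronglyMeasurable.aemeasurable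
  have hG : ∀ᵐ z, ENNReal.ofReal (hae.mk g z) = ENNReal.ofReal (g z) :=
    hae.ae_eq_mk.mono fun z hz => by rw [hz]
  refine ⟨fun z => ENNReal.ofReal (hae.mk g z), ⟨?_, ?_, ?_, ?_, ?_⟩, hG⟩
  · exact hae.measurable_mk.ennreal_ofReal
  · have hneg : ∀ᵐ z : Space N, ENNReal.ofReal (hae.mk g (-z)) = ENNReal.ofReal (g (-z)) :=
      (Measure.measurePreserving_neg (volume : Measure (Space N))).quasiMeasurePreserving.ae hG
    filter_upwards [hG, hneg] with z h1 h2
    rw [h1, h2]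
    rcases eq_or_ne z 0 with rfl | hz
    · simp
    · rw [hg2 z hz]
  · intro c hc
    have hc0 : c ≠ 0 := by linarith
    have hsmul : ∀ᵐ z : Space N,
        ENNReal.ofReal (hae.mk g (c • z)) = ENNReal.ofReal (g (c • z)) := by
      rw [ae_iff] at hG ⊢
      have := Measure.addHaar_preimage_smul (volume : Measure (Space N)) hc0
        {z | ¬ENNReal.ofReal (hae.mk g z) = ENNReal.ofReal (g z)}
      rw [hG, mul_zero] at this
      exact this
    filter_upwards [hG, hsmul] with z h1 h2
    rw [h1, h2]
    rcases eq_or_ne z 0 with rfl | hz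
    · simp
    · exact ENNReal.ofReal_le_ofReal (hg1.2 z hz c hc)
  · intro ε hε
    have hlim := ENNReal.tendsto_ofReal hg4
    rw [ENNReal.ofReal_zero] at hlim
    obtain ⟨R, -, hR⟩ := (hasBasis_cobounded_norm (E := Space N)).eventually_iff.1
      (ENNReal.tendsto_nhds_zero.1 hlim ε hε)
    refine ⟨R, ?_⟩
    filter_upwards [hG] with z hz hzR
    rw [hz]
    exact hR hzR
  · intro R
    have hint : IntegrableOn g (Metric.ball 0 R) volume :=
      (hg_loc.integrableOn_isCompact (isCompact_closedBall 0 R)).mono_set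
        Metric.ball_subset_closedBall
    rw [lintegral_congr_ae (ae_restrict_of_ae hG)]
    exact hint.lintegral_lt_top

/-- Changing the kernel on a null set changes each inner integrand only on a translate of that null
set. -/
theorem energy_eq_dropEnergy (s : ℝ) {g : Space N → ℝ} {G : Space N → ℝ≥0∞} (hG : IsRieszKernel G)
    (hgG : ∀ᵐ z, G z = ENNReal.ofReal (g z)) {A : Set (Space N)} (hA : MeasurableSet A) :
    energy s g A = dropEnergy s G A := by
  rw [energy, dropEnergy, perimeter, kernelMeasure_prod (measurable_powerKernel N s) hA hA.compl,
    kernelMeasure_prod hG.measurable hA hA, fracPerimeter, rieszPotential]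
  congr 1
  refine lintegral_congr fun y => lintegral_congr_ae (ae_restrict_of_ae ?_)
  have h := (measurePreserving_sub_right (volume : Measure (Space N)) y).quasiMeasurePreserving.ae
    hgG
  filter_upwards [h] with x hx using hx.symm

theorem energy_congr_ae (s : ℝ) (g : Space N → ℝ) {A B : Set (Space N)} (h : A =ᵐ[volume] B) :
    energy s g A = energy s g B := by
  simp only [energy, fracPerimeter, rieszPotential, Measure.restrict_congr_set h,
    Measure.restrict_congr_set h.compl]

theorem LebesgueMeasurable.exists_measurableSet {E : Set (Space N)} (hE : LebesgueMeasurable E)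
    (s : ℝ) {g : Space N → ℝ} {G : Space N → ℝ≥0∞} (hG : IsRieszKernel G)
    (hgG : ∀ᵐ z, G z = ENNReal.ofReal (g z)) :
    ∃ A : Set (Space N), MeasurableSet A ∧ volume A = volume E ∧
      dropEnergy s G A = energy s g E := by
  obtain ⟨A, -, hA, hAE⟩ := NullMeasurableSet.exists_measurable_superset_ae_eq hE
  exact ⟨A, hA, measure_congr hAE, by
    rw [← energy_eq_dropEnergy s hG hgG hA, energy_congr_ae s g hAE]⟩

theorem minEnergy_eq_dropInf (s : ℝ) {g : Space N → ℝ} {G : Space N → ℝ≥0∞} (hG : IsRieszKernel G)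
    (hgG : ∀ᵐ z, G z = ENNReal.ofReal (g z)) (t : ℝ≥0∞) :
    minEnergy s g t = dropInf s G t := by
  refine le_antisymm (le_iInf fun A => sInf_le ?_) (le_sInf ?_)
  · exact ⟨A, A.2.1.nullMeasurableSet, A.2.2, (energy_eq_dropEnergy s hG hgG A.2.1).symm⟩
  · rintro _ ⟨E, hE, hEt, rfl⟩
    obtain ⟨A, hA, hAE, hAe⟩ := hE.exists_measurableSet s hG hgG
    rw [← hAe]
    exact dropInf_le s G hA (hAE.trans hEt)

/-- The relaxed infimum bounds the generalized energy of every countable family from below. -/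
theorem relaxedInf_le_genMinEnergy (hN : 0 < N) {s : ℝ} (hs : 0 < s) {g : Space N → ℝ}
    {G : Space N → ℝ≥0∞} (hG : IsRieszKernel G) (hgG : ∀ᵐ z, G z = ENNReal.ofReal (g z))
    {m : ℝ≥0∞} (hm : m ≠ ∞) : relaxedInf s G m ≤ genMinEnergy s g m := by
  refine le_sInf ?_
  rintro _ ⟨E, ⟨hE, hEm⟩, rfl⟩
  choose A hA hAv hAe using fun k => (hE k).exists_measurableSet s hG hgG
  have hfin : ∀ k, volume (A k) ≠ ∞ := fun k =>
    ne_top_of_le_ne_top hm (by rw [hAv, ← hEm]; exact ENNReal.le_tsum k)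
  have hsum : Tendsto (fun n => ∑ k ∈ Finset.range n, volume (A k)) atTop (𝓝 m) := by
    simp_rw [hAv, ← hEm]
    exact ENNReal.tendsto_nat_tsum _
  -- Finite subfamilies have volume tending to `m` but possibly smaller than `m`; lower
  -- semicontinuity of the relaxed infimum closes the gap.
  refine (relaxedInf_le_liminf s G hsum).trans (liminf_le_of_frequently_le'
    (Frequently.of_forall fun n => ?_))
  refine (dropInf_sum_le hN hs hG (Finset.range n) hA hfin).trans ?_
  simp_rw [hAe]
  exact ENNReal.sum_le_tsum _

end LiquidDrop

theorem theorem2p2 (N : ℕ) (hN : 1 ≤ N) (s : ℝ) (hs0 : 0 < s) (hs1 : s < 1)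
    (g : LiquidDrop.Space N → ℝ)
    (hg_loc : LocallyIntegrable g volume)
    (hg1 : LiquidDrop.RadiallyNonincreasing g)
    (hg2 : LiquidDrop.SymmetricKernel g)
    (hg4 : LiquidDrop.VanishesAtInfinity g)
    (m : ℝ) (hm : 0 < m) :
    (∃ (M : ℕ) (E : ℕ → Set (LiquidDrop.Space N)),
      (∀ k, M ≤ k → E k = ∅) ∧
      LiquidDrop.IsGenMinimizer s g (ENNReal.ofReal m) E ∧
      ∑ k ∈ Finset.range M, volume (E k) = ENNReal.ofReal m ∧
      ∑ k ∈ Finset.range M, LiquidDrop.energy s g (E k)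
        = LiquidDrop.genMinEnergy s g (ENNReal.ofReal m) ∧
      ∀ k, LiquidDrop.IsMinimizer s g (E k)) ∧
    LiquidDrop.genMinEnergy s g (ENNReal.ofReal m) < ∞ ∧
    LiquidDrop.minEnergy s g (ENNReal.ofReal m)
      = LiquidDrop.genMinEnergy s g (ENNReal.ofReal m) := by
  open LiquidDrop in
  obtain ⟨G, hG, hgG⟩ := exists_isRieszKernel hg_loc hg1 hg2 hg4
  set t := ENNReal.ofReal m
  have ht0 : t ≠ 0 := (ENNReal.ofReal_pos.2 hm).ne'
  have ht : t ≠ ∞ := ENNReal.ofReal_ne_top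
  obtain ⟨M, A, hA0, hAm, hAv, hAE⟩ := exists_finite_family hN hs0 hs1 hG ht0 ht
  have hr := relaxedInf_lt_top hN hs0 hs1 hG ht
  have hgen := relaxedInf_le_genMinEnergy hN hs0 hG hgG ht
  have hfin : ∀ k, volume (A k) ≠ ∞ := by
    intro k
    rcases lt_or_ge k M with hk | hk
    · refine ne_top_of_le_ne_top ht (le_of_le_of_eq ?_ hAv)
      exact Finset.single_le_sum (f := fun k => volume (A k)) (fun _ _ => zero_le)
        (Finset.mem_range.2 hk)
    · simp [hA0 k hk]
  have hen : ∀ k, energy s g (A k) = dropEnergy s G (A k) := fun k =>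
    energy_eq_dropEnergy s hG hgG (hAm k)
  have htsumv : ∑' k, volume (A k) = t := by
    rw [tsum_eq_sum (s := Finset.range M) fun k hk => ?_, hAv]
    rw [hA0 k (by simpa using hk), measure_empty]
  have htsumE : genEnergy s g A = ∑ k ∈ Finset.range M, dropEnergy s G (A k) := by
    simp_rw [genEnergy, hen]
    refine tsum_eq_sum fun k hk => ?_
    rw [hA0 k (by simpa using hk), dropEnergy_empty]
  have hadm : IsAdmissible t A := ⟨fun k => (hAm k).nullMeasurableSet, htsumv⟩
  have hgenle : genMinEnergy s g t ≤ genEnergy s g A := sInf_le ⟨A, hadm, rfl⟩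
  have hgenr : genMinEnergy s g t = relaxedInf s G t :=
    le_antisymm (hgenle.trans (htsumE.trans_le hAE)) hgen
  have hsumE : ∑ k ∈ Finset.range M, dropEnergy s G (A k) = relaxedInf s G t :=
    le_antisymm hAE (by rw [← hgenr, ← htsumE]; exact hgenle)
  -- Finite subadditivity applied to the optimal family shows that relaxation does not lower the
  -- infimum at `t`.
  have hinf : dropInf s G t = relaxedInf s G t := by
    refine le_antisymm ?_ (relaxedInf_le_dropInf s G t)
    rw [← hsumE, ← hAv]
    exact dropInf_sum_le hN hs0 hG _ hAm hfin
  refine ⟨⟨M, A, hA0, ⟨hadm, ?_⟩, hAv, ?_, fun k => ⟨(hAm k).nullMeasurableSet,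
    fun F hF hFv => ?_⟩⟩, ?_, ?_⟩
  · rw [htsumE, hsumE, hgenr]
  · simp_rw [hen]
    rw [hsumE, hgenr]
  · rcases lt_or_ge k M with hk | hk
    · obtain ⟨B, hB, hBv, hBe⟩ := hF.exists_measurableSet s hG hgG
      rw [hFv] at hBv
      rw [hen, ← hBe]
      have hk' := Finset.mem_range.2 hk
      -- Exchanging `A k` for `B` keeps the total volume, so the new sum is still at least `dropInf
      -- s G t`. The finite energy of the other members then cancels.
      have hupd := dropInf_sum_le hN hs0 hG (Finset.range M) (A := Function.update A k B)
        (fun i => by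
          rcases eq_or_ne i k with rfl | hi
          · simpa using hB
          · simpa [hi] using hAm i)
        (fun i => by
          rcases eq_or_ne i k with rfl | hi
          · simpa [hBv] using hfin i
          · simpa [hi] using hfin i)
      have hrest : ∀ f : Set (Space N) → ℝ≥0∞,
          ∑ i ∈ (Finset.range M).erase k, f (Function.update A k B i) =
            ∑ i ∈ (Finset.range M).erase k, f (A i) := fun f =>
        Finset.sum_congr rfl fun i hi => by
          rw [Function.update_of_ne (Finset.ne_of_mem_erase hi)]
      rw [← Finset.add_sum_erase _ _ hk', ← Finset.add_sum_erase _ _ hk',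
        hrest fun C => volume C, hrest (dropEnergy s G), Function.update_self, hBv,
        Finset.add_sum_erase _ (fun i => volume (A i)) hk', hAv, hinf, ← hsumE,
        ← Finset.add_sum_erase _ _ hk'] at hupd
      refine (ENNReal.add_le_add_iff_right ?_).1 hupd
      refine ne_top_of_le_ne_top hr.ne (le_of_le_of_eq ?_ hsumE)
      exact Finset.sum_le_sum_of_subset (Finset.erase_subset _ _)
    · rw [hA0 k hk, energy_eq_dropEnergy s hG hgG MeasurableSet.empty, dropEnergy_empty]
      exact zero_le
  · rwa [hgenr]
  · rw [minEnergy_eq_dropInf s hG hgG, hinf, hgenr]
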